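/- Let $m\ge 2$ and $n\ge m+2$; all indices below are cyclic modulo $n$. A spherical $n$-gon $v=(v_i)$ is a cyclic sequence of $n$ unit vectors in $\mathbb R^m$; it is called generic if every $m$ cyclically consecutive vectors $v_i,\dots,v_{i+m-1}$ are linearly independent. For such $v$ let $\mathcal P_v$ be the $(n-m)$-dimensional real vector space of closed polygons $P=(P_i)$ in $\mathbb R^m$ with $P_{i+1}-P_i\in\mathbb R v_i$ for all $i$ (sides of zero length are allowed), considered up to parallel translation. The dual polygon $v^*$ consists of the positive unit normals $v^*_i$ of the hyperplanes spanned by $v_{i+1},\dots,v_{i+m-1}$, that is, $\det(v_{i+1},\dots,v_{i+m-1},v^*_i)>0$. The evolute $\mathcal E(P)$ of $P\in\mathcal P_v$ is the polygon whose vertices are the centers of the spheres through the $(m+1)$-tuples $P_i,\dots,P_{i+m}$ of consecutive vertices, i.e. the common points of the perpendicular bisector hyperplanes of the $m$ sides $i,\dots,i+m-1$, where the bisector hyperplane of side $j$ is the hyperplane orthogonal to $v_j$ through the midpoint of $P_j$ and $P_{j+1}$ (also when $P_j=P_{j+1}$). This gives linear maps $\mathcal E\colon\mathcal P_v\to\mathcal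 P_{v^*}$ and $\mathcal E\colon\mathcal P_{v^*}\to\mathcal P_{v^{**}}=\mathcal P_v$ (the vectors of $v^{**}$ are those of $v$ up to sign), and, with the vertices numbered so that side $i$ of the second evolute is parallel to side $i$ of the original polygon, a linear map $\mathcal E^2\colon\mathcal P_v\to\mathcal P_v$. **Theorem.** Let $v$ be a generic spherical $n$-gon. Then every non-zero complex eigenvalue of $\mathcal E^2\colon\mathcal P_v\to\mathcal P_v$ has even algebraic multiplicity. More precisely, in a suitable basis of the image $\mathcal E(\mathcal P_{v^*})\subset\mathcal P_v$, the restriction of $\mathcal E^2$ to this image has a block-diagonal matrix $$\begin{pmatrix}A&0\\0&A^{\mathrm T}\end{pmatrix}$$ with a real square matrix $A$. Moreover, there is a dense open set of spherical $n$-gons in $(S^{m-1})^n$, all of them generic, for which every non-zero complex eigenvalue of $\mathcal E^2$ has algebraic multiplicity exactly $2$. -/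

import Mathlib

/-- Euclidean space `ℝ^m`. -/
abbrev Vec (m : ℕ) : Type := EuclideanSpace ℝ (Fin m)

section Directions

variable {n m : ℕ}

/-- The matrix whose rows are the `m` cyclically consecutive vectors
`v i, v (i + 1), …, v (i + m - 1)`. -/
def rowMatrix (v : ZMod n → Vec m) (i : ZMod n) : Matrix (Fin m) (Fin m) ℝ :=
  Matrix.of fun r c => v (i + ((r : ℕ) : ZMod n)) c

/-- A cyclic sequence of vectors is generic if every `m` cyclically consecutive members
of it are linearly independent. -/
def IsGeneric (v : ZMod n → Vec m) : Prop :=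
  ∀ i : ZMod n, LinearIndependent ℝ fun r : Fin m => v (i + ((r : ℕ) : ZMod n))

/-- Closed `n`-gons `P` (given by their vertices) whose `i`-th side, joining `P i` to `P (i + 1)`,
is parallel to `v i`. Sides of length zero are allowed: they carry the direction `v i`. -/
def polygons (v : ZMod n → Vec m) : Submodule ℝ (ZMod n → Vec m) where
  carrier := {P | ∀ i, P (i + 1) - P i ∈ Submodule.span ℝ {v i}}
  zero_mem' := fun i => by simp
  add_mem' := fun {P Q} hP hQ i => by
    have h : (P + Q) (i + 1) - (P + Q) i = (P (i + 1) - P i) + (Q (i + 1) - Q i) := by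
      simp only [Pi.add_apply]; abel
    rw [h]
    exact Submodule.add_mem _ (hP i) (hQ i)
  smul_mem' := fun c P hP i => by
    have h : (c • P) (i + 1) - (c • P) i = c • (P (i + 1) - P i) := by
      simp only [Pi.smul_apply, smul_sub]
    rw [h]
    exact Submodule.smul_mem _ c (hP i)

/-- The constant sequences; adding one of them to a polygon is a parallel translation. -/
def translations (n m : ℕ) : Submodule ℝ (ZMod n → Vec m) :=
  LinearMap.range (LinearMap.pi fun _ : ZMod n => (LinearMap.id : Vec m →ₗ[ℝ] Vec m))

/-- The space `P_v` of closed `n`-gons with sides parallel to the vectors `v i`,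
considered up to parallel translation. -/
abbrev PolygonSpace (v : ZMod n → Vec m) : Type :=
  ↥(polygons v) ⧸ (translations n m).submoduleOf (polygons v)

/-- The vertex of the evolute that belongs to the sides `i, i + 1, …, i + m - 1` of `P`, that is,
to the vertices `P i, …, P (i + m)`: the common point of the perpendicular bisector hyperplanes of
these sides. The bisector hyperplane of side `j` is the hyperplane orthogonal to `v j` through
the midpoint of `P j` and `P (j + 1)`, also when these two vertices coincide. -/
noncomputable def evoluteVertex (v P : ZMod n → Vec m) (i : ZMod n) : Vec m :=
  WithLp.toLp 2 ((rowMatrix v i)⁻¹.mulVec fun r : Fin m =>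
    inner ℝ (v (i + ((r : ℕ) : ZMod n)))
      (midpoint ℝ (P (i + ((r : ℕ) : ZMod n))) (P (i + ((r : ℕ) : ZMod n) + 1))))

/-- The evolute of `P` as a linear map on sequences of vertices. Vertex number `i` of the evolute
is the centre of the sphere through `P (i - c), …, P (i - c + m)`; the integer `c` only fixes how
the vertices of the evolute are numbered. -/
noncomputable def evoluteVertices (v : ZMod n → Vec m) (c : ZMod n) :
    (ZMod n → Vec m) →ₗ[ℝ] (ZMod n → Vec m) where
  toFun P i := evoluteVertex v P (i - c)
  map_add' P Q := by
    funext i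
    simp only [evoluteVertex, Pi.add_apply, ← WithLp.toLp_add, ← Matrix.mulVec_add]
    congr 2
    funext r
    simp only [Pi.add_apply, midpoint_eq_smul_add, inner_smul_right, inner_add_right]
    ring
  map_smul' a P := by
    funext i
    simp only [evoluteVertex, Pi.smul_apply, RingHom.id_apply, ← WithLp.toLp_smul,
      ← Matrix.mulVec_smul]
    congr 2
    funext r
    simp only [Pi.smul_apply, midpoint_eq_smul_add, inner_smul_right, inner_add_right, smul_eq_mul]
    ring

theorem det_rowMatrix_ne_zero {v : ZMod n → Vec m} (hv : IsGeneric v) (i : ZMod n) :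
    (rowMatrix v i).det ≠ 0 := by
  have h := (hv i).map' (WithLp.linearEquiv 2 ℝ (Fin m → ℝ)).toLinearMap (LinearEquiv.ker _)
  have h2 : LinearIndependent ℝ (rowMatrix v i).row := h
  rw [Matrix.linearIndependent_rows_iff_isUnit, Matrix.isUnit_iff_isUnit_det] at h2
  exact h2.ne_zero

theorem isGeneric_of_det {v : ZMod n → Vec m} (h : ∀ i, (rowMatrix v i).det ≠ 0) :
    IsGeneric v := by
  intro i
  have h2 : LinearIndependent ℝ (rowMatrix v i).row := by
    rw [Matrix.linearIndependent_rows_iff_isUnit, Matrix.isUnit_iff_isUnit_det]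
    exact (h i).isUnit
  exact LinearIndependent.of_comp (WithLp.linearEquiv 2 ℝ (Fin m → ℝ)).toLinearMap h2

theorem inner_eq_rowMatrix_mulVec (v : ZMod n → Vec m) (i : ZMod n) (w : Vec m) (r : Fin m) :
    inner ℝ (v (i + ((r : ℕ) : ZMod n))) w = (rowMatrix v i).mulVec w.ofLp r := by
  simp only [PiLp.inner_apply, Matrix.mulVec, dotProduct, rowMatrix, Matrix.of_apply]
  refine Finset.sum_congr rfl fun k _ => ?_
  simp [mul_comm]

theorem eq_zero_of_inner {v : ZMod n → Vec m} (hv : IsGeneric v) (i : ZMod n) {w : Vec m}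
    (hw : ∀ r : Fin m, inner ℝ (v (i + ((r : ℕ) : ZMod n))) w = 0) : w = 0 := by
  have h : (rowMatrix v i).mulVec w.ofLp = 0 := by
    funext r
    rw [← inner_eq_rowMatrix_mulVec, hw r]; rfl
  have h2 := Matrix.eq_zero_of_mulVec_eq_zero (det_rowMatrix_ne_zero hv i) h
  ext k
  exact congrFun h2 k

theorem inner_evoluteVertex {v : ZMod n → Vec m} (hv : IsGeneric v) (P : ZMod n → Vec m)
    (i : ZMod n) (r : Fin m) :
    inner ℝ (v (i + ((r : ℕ) : ZMod n))) (evoluteVertex v P i) =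
      inner ℝ (v (i + ((r : ℕ) : ZMod n)))
        (midpoint ℝ (P (i + ((r : ℕ) : ZMod n))) (P (i + ((r : ℕ) : ZMod n) + 1))) := by
  rw [inner_eq_rowMatrix_mulVec]
  simp only [evoluteVertex]
  rw [Matrix.mulVec_mulVec, Matrix.mul_nonsing_inv _ (det_rowMatrix_ne_zero hv i).isUnit,
    Matrix.one_mulVec]

/-- A side of the evolute is orthogonal to `m - 1` consecutive sides of the polygon. -/
theorem inner_evoluteVertex_sub {v : ZMod n → Vec m} (hv : IsGeneric v) (P : ZMod n → Vec m)
    (i : ZMod n) (r : ℕ) (hr : r + 1 < m) :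
    inner ℝ (v (i + 1 + (r : ZMod n))) (evoluteVertex v P (i + 1) - evoluteVertex v P i) = 0 := by
  have h1 := inner_evoluteVertex hv P (i + 1) ⟨r, by omega⟩
  have h2 := inner_evoluteVertex hv P i ⟨r + 1, hr⟩
  have e : i + ((r + 1 : ℕ) : ZMod n) = i + 1 + (r : ZMod n) := by push_cast; ring
  simp only [e] at h1 h2
  rw [inner_sub_right, h1, h2, sub_self]

/-- In a basis `v i, …, v (i + m - 1)`, two vectors orthogonal to all members but the last one are
proportional. -/
theorem mem_span_of_inner {v : ZMod n → Vec m} (hv : IsGeneric v) (i : ZMod n) {t w : Vec m}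
    (ht0 : t ≠ 0) (ht : ∀ r : ℕ, r + 1 < m → inner ℝ (v (i + (r : ZMod n))) t = 0)
    (hw : ∀ r : ℕ, r + 1 < m → inner ℝ (v (i + (r : ZMod n))) w = 0) :
    w ∈ Submodule.span ℝ {t} := by
  set a := inner ℝ (v (i + ((m - 1 : ℕ) : ZMod n))) t with ha
  set b := inner ℝ (v (i + ((m - 1 : ℕ) : ZMod n))) w with hb
  have ha0 : a ≠ 0 := by
    intro h0
    refine ht0 (eq_zero_of_inner hv i fun r => ?_)
    by_cases hr : (r : ℕ) + 1 < m
    · exact ht r hr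
    · have e : (r : ℕ) = m - 1 := by omega
      rw [e, ← ha, h0]
  have hz : w - (b / a) • t = 0 := by
    refine eq_zero_of_inner hv i fun r => ?_
    rw [inner_sub_right, inner_smul_right]
    by_cases hr : (r : ℕ) + 1 < m
    · rw [ht r hr, hw r hr]; simp
    · have e : (r : ℕ) = m - 1 := by omega
      rw [e, ← ha, ← hb]
      field_simp
      simp
  rw [Submodule.mem_span_singleton]
  exact ⟨b / a, (sub_eq_zero.mp hz).symm⟩

/-- A translation of the polygon translates its evolute. -/
theorem evoluteVertices_mem_translations {v : ZMod n → Vec m} (hv : IsGeneric v) (c : ZMod n)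
    {P : ZMod n → Vec m} (hP : P ∈ translations n m) :
    evoluteVertices v c P ∈ translations n m := by
  obtain ⟨p, rfl⟩ := hP
  refine ⟨p, ?_⟩
  funext i
  simp only [evoluteVertices, LinearMap.coe_mk, AddHom.coe_mk, LinearMap.pi_apply,
    LinearMap.id_apply]
  refine (sub_eq_zero.mp (eq_zero_of_inner hv (i - c) fun r => ?_)).symm
  rw [inner_sub_right, inner_evoluteVertex hv]
  simp

end Directions

section Dual

variable {n m : ℕ} [NeZero m]

/-- The generalized cross product of `v (i + 1), …, v (i + m - 1)`: its `k`-th coordinate is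
`det (v (i + 1), …, v (i + m - 1), e_k)`. (`Fin.rev 0` is the last row.) -/
noncomputable def crossVector (v : ZMod n → Vec m) (i : ZMod n) : Vec m :=
  WithLp.toLp 2 fun k =>
    ((rowMatrix v (i + 1)).updateRow (Fin.rev 0) (Pi.single k 1)).det

/-- The dual spherical polygon `v^*`: `dualPolygon v i` is the positive unit normal vector of the
hyperplane spanned by `v (i + 1), …, v (i + m - 1)`. -/
noncomputable def dualPolygon (v : ZMod n → Vec m) (i : ZMod n) : Vec m :=
  ‖crossVector v i‖⁻¹ • crossVector v i

theorem inner_crossVector (v : ZMod n → Vec m) (i : ZMod n) (r : Fin m) :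
    inner ℝ (v (i + 1 + ((r : ℕ) : ZMod n))) (crossVector v i) =
      if r = Fin.rev 0 then (rowMatrix v (i + 1)).det else 0 := by
  rw [inner_eq_rowMatrix_mulVec]
  have h := congrFun (congrFun (Matrix.mul_adjugate (rowMatrix v (i + 1))) r) (Fin.rev 0)
  simp only [Matrix.mul_apply, Matrix.adjugate_apply, Matrix.smul_apply, Matrix.one_apply,
    smul_eq_mul, mul_ite, mul_one, mul_zero] at h
  simpa only [crossVector, Matrix.mulVec, dotProduct] using h

theorem inner_crossVector_eq_zero (v : ZMod n → Vec m) (i : ZMod n) (r : ℕ) (hr : r + 1 < m) :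
    inner ℝ (v (i + 1 + (r : ZMod n))) (crossVector v i) = 0 := by
  have h := inner_crossVector v i ⟨r, by omega⟩
  rw [if_neg] at h
  · exact h
  · intro e
    have := congrArg Fin.val e
    simp at this
    omega

theorem inner_crossVector_last (v : ZMod n → Vec m) (i : ZMod n) :
    inner ℝ (v (i + (m : ZMod n))) (crossVector v i) = (rowMatrix v (i + 1)).det := by
  have h := inner_crossVector v i (Fin.rev 0)
  rw [if_pos rfl] at h
  rw [← h]
  congr 2
  have hm := NeZero.pos m
  have e : m = 1 + ((Fin.rev (0 : Fin m)) : ℕ) := by simp; omega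
  calc i + (m : ZMod n) = i + ((1 + ((Fin.rev (0 : Fin m)) : ℕ) : ℕ) : ZMod n) := by rw [← e]
    _ = _ := by push_cast; ring

theorem crossVector_ne_zero {v : ZMod n → Vec m} (hv : IsGeneric v) (i : ZMod n) :
    crossVector v i ≠ 0 := by
  intro h
  have h2 := inner_crossVector_last v i
  rw [h, inner_zero_right] at h2
  exact det_rowMatrix_ne_zero hv (i + 1) h2.symm

theorem dualPolygon_ne_zero {v : ZMod n → Vec m} (hv : IsGeneric v) (i : ZMod n) :
    dualPolygon v i ≠ 0 :=
  smul_ne_zero (inv_ne_zero (norm_ne_zero_iff.mpr (crossVector_ne_zero hv i)))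
    (crossVector_ne_zero hv i)

theorem inner_dualPolygon_eq_zero (v : ZMod n → Vec m) (i : ZMod n) (r : ℕ) (hr : r + 1 < m) :
    inner ℝ (v (i + 1 + (r : ZMod n))) (dualPolygon v i) = 0 := by
  rw [dualPolygon, inner_smul_right, inner_crossVector_eq_zero v i r hr, mul_zero]

theorem inner_dualPolygon_last_ne_zero {v : ZMod n → Vec m} (hv : IsGeneric v) (i : ZMod n) :
    inner ℝ (v (i + (m : ZMod n))) (dualPolygon v i) ≠ 0 := by
  rw [dualPolygon, inner_smul_right, inner_crossVector_last]
  exact mul_ne_zero (inv_ne_zero (norm_ne_zero_iff.mpr (crossVector_ne_zero hv i)))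
    (det_rowMatrix_ne_zero hv (i + 1))

/-- The dual of a generic spherical polygon is generic. -/
theorem isGeneric_dualPolygon {v : ZMod n → Vec m} (hv : IsGeneric v) :
    IsGeneric (dualPolygon v) := by
  refine isGeneric_of_det fun i => ?_
  have hent : ∀ r s : Fin m,
      (rowMatrix (dualPolygon v) i * (rowMatrix v (i + (m : ZMod n))).transpose) r s =
        inner ℝ (v (i + (m : ZMod n) + ((s : ℕ) : ZMod n)))
          (dualPolygon v (i + ((r : ℕ) : ZMod n))) := by
    intro r s
    rw [inner_eq_rowMatrix_mulVec]
    simp only [Matrix.mul_apply, Matrix.mulVec, dotProduct, Matrix.transpose_apply]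
    refine Finset.sum_congr rfl fun k _ => ?_
    simp [rowMatrix, mul_comm]
  have htri : (rowMatrix (dualPolygon v) i *
      (rowMatrix v (i + (m : ZMod n))).transpose).BlockTriangular id := by
    intro r s hsr
    have hsr' : (s : ℕ) < r := hsr
    rw [hent]
    have e : i + (m : ZMod n) + ((s : ℕ) : ZMod n) =
        i + ((r : ℕ) : ZMod n) + 1 + ((m + s - r - 1 : ℕ) : ZMod n) := by
      have h : m + (s : ℕ) = r + 1 + (m + s - r - 1) := by omega
      have h2 := congrArg (Nat.cast : ℕ → ZMod n) h
      push_cast at h2 ⊢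
      linear_combination h2
    rw [e]
    exact inner_dualPolygon_eq_zero v _ _ (by omega)
  have hdet := Matrix.det_of_isUpperTriangular htri
  rw [Matrix.det_mul] at hdet
  intro h0
  rw [h0, zero_mul] at hdet
  refine Finset.prod_ne_zero_iff.mpr (fun r _ => ?_) hdet.symm
  rw [hent]
  have h := inner_dualPolygon_last_ne_zero hv (i + ((r : ℕ) : ZMod n))
  convert h using 3
  ring

/-- The evolute of a polygon with sides along `v` has sides along `v^*`. -/
theorem evoluteVertices_mem_dual {v : ZMod n → Vec m} (hv : IsGeneric v) (P : ZMod n → Vec m) :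
    evoluteVertices v 0 P ∈ polygons (dualPolygon v) := by
  intro i
  simp only [evoluteVertices, LinearMap.coe_mk, AddHom.coe_mk, sub_zero]
  exact mem_span_of_inner hv (i + 1) (dualPolygon_ne_zero hv i)
    (inner_dualPolygon_eq_zero v i) (inner_evoluteVertex_sub hv P i)

/-- The evolute of a polygon with sides along `v^*` has sides along `v`. -/
theorem evoluteVertices_dual_mem {v : ZMod n → Vec m} (hv : IsGeneric v) (Q : ZMod n → Vec m) :
    evoluteVertices (dualPolygon v) (m : ZMod n) Q ∈ polygons v := by
  intro i
  simp only [evoluteVertices, LinearMap.coe_mk, AddHom.coe_mk]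
  rw [show i + 1 - (m : ZMod n) = i - (m : ZMod n) + 1 by ring]
  refine mem_span_of_inner (isGeneric_dualPolygon hv) (i - (m : ZMod n) + 1) ?_ ?_
    (inner_evoluteVertex_sub (isGeneric_dualPolygon hv) Q _)
  · have h := (hv i).ne_zero 0
    simpa using h
  · intro r hr
    have h := inner_dualPolygon_eq_zero v (i - (m : ZMod n) + 1 + (r : ZMod n)) (m - 2 - r)
      (by omega)
    rw [real_inner_comm]
    convert h using 3
    have h2 := congrArg (Nat.cast : ℕ → ZMod n) (show m = 2 + r + (m - 2 - r) by omega)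
    push_cast at h2
    linear_combination h2

/-- The evolute map `P_v → P_{v^*}`. Vertex `i` of the evolute is the centre of the sphere
through `P i, …, P (i + m)`. -/
noncomputable def evolute (v : ZMod n → Vec m) (hv : IsGeneric v) :
    PolygonSpace v →ₗ[ℝ] PolygonSpace (dualPolygon v) :=
  Submodule.mapQ _ _
    ((evoluteVertices v 0).restrict fun P _ => evoluteVertices_mem_dual hv P)
    fun _ hP => evoluteVertices_mem_translations hv 0 hP

/-- The evolute map `P_{v^*} → P_{v^{**}} = P_v` (the vectors of `v^{**}` are those of `v` up to
sign). Vertex `i` of the evolute is the centre of the sphere through `Q (i - m), …, Q i`; with this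
numbering side `i` of the second evolute is parallel to side `i` of the original polygon. -/
noncomputable def evoluteOfDual (v : ZMod n → Vec m) (hv : IsGeneric v) :
    PolygonSpace (dualPolygon v) →ₗ[ℝ] PolygonSpace v :=
  Submodule.mapQ _ _
    ((evoluteVertices (dualPolygon v) (m : ZMod n)).restrict
      fun Q _ => evoluteVertices_dual_mem hv Q)
    fun _ hQ => evoluteVertices_mem_translations (isGeneric_dualPolygon hv) (m : ZMod n) hQ

/-- The second evolute map `E² : P_v → P_v`. -/
noncomputable def secondEvolute (v : ZMod n → Vec m) (hv : IsGeneric v) :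
    PolygonSpace v →ₗ[ℝ] PolygonSpace v :=
  evoluteOfDual v hv ∘ₗ evolute v hv

/-- The image in `P_v` of the evolute map `E : P_{v^*} → P_v`. -/
noncomputable def evoluteImage (v : ZMod n → Vec m) (hv : IsGeneric v) :
    Submodule ℝ (PolygonSpace v) :=
  LinearMap.range (evoluteOfDual v hv)

/-- The restriction of `E²` to the image of `E`. -/
noncomputable def secondEvoluteOnImage (v : ZMod n → Vec m) (hv : IsGeneric v) :
    ↥(evoluteImage v hv) →ₗ[ℝ] ↥(evoluteImage v hv) :=
  (secondEvolute v hv).restrict fun x _ => ⟨evolute v hv x, rfl⟩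

/-- The (algebraic) multiplicity of `μ : ℂ` as an eigenvalue of `E²`; it is `0` when `μ` is not
an eigenvalue. -/
noncomputable def eigenvalueMultiplicity [NeZero n] (v : ZMod n → Vec m) (hv : IsGeneric v)
    (μ : ℂ) : ℕ :=
  ((secondEvolute v hv).charpoly.map (algebraMap ℝ ℂ)).rootMultiplicity μ

end Dual

/-- A spherical `n`-gon: a cyclic sequence of `n` points of the unit sphere `S^{m-1}`. -/
abbrev SphericalPolygon (n m : ℕ) : Type := ZMod n → Metric.sphere (0 : Vec m) 1

/-- The vertices of a spherical polygon as vectors of `ℝ^m`. -/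
def SphericalPolygon.vec {n m : ℕ} (v : SphericalPolygon n m) : ZMod n → Vec m :=
  fun i => (v i : Vec m)

/-!
A polygon `Q` with sides along `v^*` is cut out by hyperplanes with normals `v j`, and a polygon `P`
with sides along `v` has side lengths in units of `v j`. The pairing
`⟨Q, P⟩ = ∑ j, ⟪Q j, P (j + 1) - P j⟫` (`polygonPairing`) is the sum of the products of heights and
side lengths, so it makes `P_{v^*}` the dual space of `P_v`. Both evolute maps are skew for it:
`⟨E P, P⟩ = 0`, because `E P` may be replaced by the midpoints of the sides of `P`
(`polygonPairing_evolute_self`), and `⟨Q, E Q'⟩` is the mixed signed area of `Q` and `Q'`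
(`polygonPairing_evoluteOfDual_mk`). Hence `ω (E Q, x) = ⟨Q, x⟩` is a symplectic form on the image
of `E`, and `ω (E² x, x) = ⟨E x, x⟩ = 0`. An operator that is self-adjoint for a symplectic form
preserves two complementary Lagrangian subspaces; bases of them that are dual for `ω` give the
matrix `diag(A, Aᵀ)` (`exists_basis_toMatrix_eq_fromBlocks_transpose`). The Lagrangian subspaces are
built by splitting off dual pairs of cyclic subspaces (`exists_cyclic_pair`). The characteristic
polynomial of `E²` is then, up to a power of `X`, the square of that of `A`, and the multiplicities
are even (`even_eigenvalueMultiplicity`).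

The dimension of `P_v` is at most `n - m`, so with `r = (n - m) / 2` there are at most `r` distinct
nonzero eigenvalues, and if there are `r` of them, all have multiplicity `2`. There are at least `r`
if the Hankel determinant of the traces of `E² ^ (i + j + 1)`, `i, j < r`, does not vanish
(`rootMultiplicity_eq_two`). In terms of side lengths `E²` is a matrix with rational entries in the
coordinates of the `v j` (`trace_secondEvolute_pow`); clearing denominators one obtains a polynomial
`nondegeneracyPoly` which is nonzero exactly where `v` is generic and the Hankel determinant does
not vanish. Its nonvanishing defines an open set, which is dense as soon as it is nonempty
(`dense_nondegeneratePolygons`).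

To find one point at which the polynomial does not vanish, the coordinates are stretched by
different factors, so that only the last coordinate matters in the first evolute and only the first
one in the second evolute (`exists_nondegeneracyPoly_ne_zero`). For a suitable sequence of
directions, in which each vector after the first `m` is a small perturbation of the sum of its
predecessor and the first basis vector, the resulting matrix tends to one whose power traces are those of `-Z ^ 2`, where `Z`
is the skew-symmetric adjacency matrix of a path with `n - m` vertices
(`det_hankelTrace_model_ne_zero`). The Hankel matrix of `-Z ^ 2 = Zᵀ Z` is positive definite because
`Z, Z ^ 3, …, Z ^ (2 * r - 1)` are linearly independent (`det_hankelTrace_neg_sq_ne_zero`).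
-/

/-! ### Operators that are self-adjoint for a symplectic form -/

section Symplectic

variable {U : Type*} [AddCommGroup U] [Module ℝ U]

theorem exists_forall_apply_eq_of_linearIndependent {d : ℕ} {φ : Fin d → U →ₗ[ℝ] ℝ}
    (hφ : LinearIndependent ℝ φ) (a : Fin d → ℝ) : ∃ w : U, ∀ i, φ i w = a i := by
  have hr : LinearMap.range (LinearMap.pi φ) = ⊤ := by
    by_contra h
    obtain ⟨f, hf0, hf⟩ := Submodule.exists_le_ker_of_lt_top _ (lt_top_iff_ne_top.mpr h)
    refine hf0 ?_
    have hfs : ∀ y : Fin d → ℝ, f y = ∑ i, y i * f (Pi.single i 1) := by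
      intro y
      conv_lhs => rw [LinearMap.pi_apply_eq_sum_univ f y]
      refine Finset.sum_congr rfl fun i _ => ?_
      rw [smul_eq_mul]
      congr 2
      funext j
      simp [Pi.single_apply, eq_comm]
    have h0 : ∑ i, f (Pi.single i 1) • φ i = 0 := by
      ext w
      have h1 : f (LinearMap.pi φ w) = 0 := hf ⟨w, rfl⟩
      rw [hfs] at h1
      simpa [mul_comm] using h1
    have h2 := Fintype.linearIndependent_iff.mp hφ _ h0
    ext y
    simp [h2]
  obtain ⟨w, hw⟩ := LinearMap.range_eq_top.mp hr a
  exact ⟨w, fun i => congrFun hw i⟩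

/-- A Hankel system with zeros above a nonzero antidiagonal is nonsingular. -/
theorem eq_zero_of_antitriangular {d : ℕ} {g : ℕ → ℝ} (hg : ∀ k, k + 1 < d → g k = 0)
    (hg1 : g (d - 1) ≠ 0) {c : Fin d → ℝ} (hc : ∀ j < d, ∑ i : Fin d, c i * g (i + j) = 0) :
    c = 0 := by
  have key : ∀ j, ∀ i : Fin d, d ≤ (i : ℕ) + j + 1 → c i = 0 := by
    intro j
    induction j using Nat.strong_induction_on with
    | _ j ih =>
      intro i hi
      by_cases hlt : d ≤ (i : ℕ) + (j - 1) + 1 ∧ 0 < j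
      · exact ih (j - 1) (by omega) i hlt.1
      have hij : (i : ℕ) + j = d - 1 := by have := i.2; omega
      have h := hc j (by have := i.2; omega)
      rw [Finset.sum_eq_single i] at h
      · rw [hij] at h
        exact (mul_eq_zero.mp h).resolve_right hg1
      · intro b _ hb
        rcases lt_or_gt_of_ne (fun e => hb (Fin.ext e) : (b : ℕ) ≠ i) with hlt' | hgt
        · rw [hg _ (by omega), mul_zero]
        · have hb2 := b.2
          rw [ih (d - 1 - b) (by omega) b (by omega), zero_mul]
      · simp
  funext i
  exact key d i (by omega)

variable (ω : U →ₗ[ℝ] U →ₗ[ℝ] ℝ) (T : U →ₗ[ℝ] U)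

/-- The span of the first `d` members of the orbit of `u` under `T`. -/
def orbitSpan (d : ℕ) (u : U) : Submodule ℝ U :=
  Submodule.span ℝ (Set.range fun i : Fin d => (T ^ (i : ℕ)) u)

variable {ω T}

theorem map_mem_orbitSpan {d : ℕ} {u : U} (h : (T ^ d) u ∈ orbitSpan T d u) {x : U}
    (hx : x ∈ orbitSpan T d u) : T x ∈ orbitSpan T d u := by
  have : orbitSpan T d u ≤ (orbitSpan T d u).comap T := by
    refine Submodule.span_le.mpr ?_
    rintro _ ⟨i, rfl⟩
    have e : T ((T ^ (i : ℕ)) u) = (T ^ ((i : ℕ) + 1)) u := by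
      rw [pow_succ', Module.End.mul_apply]
    simp only [Submodule.comap_coe, Set.mem_preimage, SetLike.mem_coe]
    rw [e]
    by_cases hi : (i : ℕ) + 1 < d
    · exact Submodule.subset_span ⟨⟨(i : ℕ) + 1, hi⟩, rfl⟩
    · have e2 : (i : ℕ) + 1 = d := by have := i.2; omega
      rwa [e2]
  exact this hx

theorem orbitSpan_le {W : Submodule ℝ U} (hW : ∀ x ∈ W, T x ∈ W) {u : U} (hu : u ∈ W) (d : ℕ) :
    orbitSpan T d u ≤ W := by
  have h : ∀ k, (T ^ k) u ∈ W := by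
    intro k
    induction k with
    | zero => simpa using hu
    | succ k ih => rw [pow_succ', Module.End.mul_apply]; exact hW _ ih
  refine Submodule.span_le.mpr ?_
  rintro _ ⟨i, rfl⟩
  exact h i

theorem form_swap (hω : ∀ x, ω x x = 0) (x y : U) : ω x y = -ω y x := by
  have h := hω (x + y)
  simp only [map_add, LinearMap.add_apply, hω] at h
  linarith

theorem form_map_left (hω : ∀ x, ω x x = 0) (hT : ∀ x, ω (T x) x = 0)
    (x y : U) : ω (T x) y = ω x (T y) := by
  have h := hT (x + y)
  simp only [map_add, LinearMap.add_apply, hT] at h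
  rw [form_swap hω x (T y)]
  linarith

theorem form_pow_left (hω : ∀ x, ω x x = 0) (hT : ∀ x, ω (T x) x = 0)
    (k : ℕ) (x y : U) : ω ((T ^ k) x) y = ω x ((T ^ k) y) := by
  induction k generalizing x y with
  | zero => simp
  | succ k ih =>
    rw [pow_succ', Module.End.mul_apply, form_map_left hω hT, ih, ← Module.End.mul_apply,
      ← pow_succ, pow_succ']

theorem form_pow_pow (hω : ∀ x, ω x x = 0) (hT : ∀ x, ω (T x) x = 0)
    (i j : ℕ) (x y : U) : ω ((T ^ i) x) ((T ^ j) y) = ω ((T ^ (i + j)) x) y := by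
  rw [← form_pow_left hω hT j, ← Module.End.mul_apply, ← pow_add, add_comm]

theorem form_pow_self (hω : ∀ x, ω x x = 0) (hT : ∀ x, ω (T x) x = 0)
    (k : ℕ) (x : U) : ω ((T ^ k) x) x = 0 := by
  have h1 := form_pow_left hω hT k x x
  have h2 := form_swap hω ((T ^ k) x) x
  linarith

theorem orbitSpan_isotropic (hω : ∀ x, ω x x = 0) (hT : ∀ x, ω (T x) x = 0)
    (d : ℕ) (u : U) {x y : U} (hx : x ∈ orbitSpan T d u)
    (hy : y ∈ orbitSpan T d u) : ω x y = 0 := by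
  have h1 : orbitSpan T d u ≤ LinearMap.ker (ω.flip y) := by
    refine Submodule.span_le.mpr ?_
    rintro _ ⟨i, rfl⟩
    have h2 : orbitSpan T d u ≤ LinearMap.ker (ω ((T ^ (i : ℕ)) u)) := by
      refine Submodule.span_le.mpr ?_
      rintro _ ⟨j, rfl⟩
      simp only [SetLike.mem_coe, LinearMap.mem_ker]
      rw [form_pow_pow hω hT, form_pow_self hω hT]
    have := h2 hy
    simpa using this
  simpa using h1 hx

/-- A largest number `d` such that some vector of `W` has `d` linearly independent first members of
its orbit. -/
theorem exists_linearIndependent_orbit_maximal [FiniteDimensional ℝ U] {W : Submodule ℝ U} {x : U}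
    (hx : x ∈ W) (hx0 : x ≠ 0) :
    ∃ d, 1 ≤ d ∧ (∃ u ∈ W, LinearIndependent ℝ fun i : Fin d => (T ^ (i : ℕ)) u) ∧
      ∀ u ∈ W, (LinearIndependent ℝ fun i : Fin d => (T ^ (i : ℕ)) u) →
        (T ^ d) u ∈ orbitSpan T d u := by
  by_contra hcon
  push Not at hcon
  have hall : ∀ d, ∃ u ∈ W, LinearIndependent ℝ fun i : Fin (d + 1) => (T ^ (i : ℕ)) u := by
    intro d
    induction d with
    | zero =>
      refine ⟨x, hx, ?_⟩
      rw [Fintype.linearIndependent_iff]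
      intro c hc i
      have hi : i = ⟨0, by omega⟩ := Fin.ext (by omega)
      rw [Fin.sum_univ_succ] at hc
      rw [hi]
      simpa [hx0] using hc
    | succ d ih =>
      obtain ⟨u, hu, hind, hnot⟩ := hcon (d + 1) (by omega) ih
      refine ⟨u, hu, ?_⟩
      have h := linearIndependent_finSnoc.mpr ⟨hind, hnot⟩
      have e : (fun i : Fin (d + 1 + 1) => (T ^ (i : ℕ)) u) =
          Fin.snoc (fun i : Fin (d + 1) => (T ^ (i : ℕ)) u) ((T ^ (d + 1)) u) := by
        funext i
        refine Fin.lastCases ?_ (fun j => ?_) i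
        · simp
        · simp
      rw [e]
      exact h
  obtain ⟨u, -, hu⟩ := hall (Module.finrank ℝ U)
  have := hu.fintype_card_le_finrank
  simp at this

/-- A form is nondegenerate on a subspace, and the subspace is invariant under the operator. -/
def IsNondegInvariant (ω : U →ₗ[ℝ] U →ₗ[ℝ] ℝ) (T : U →ₗ[ℝ] U) (W : Submodule ℝ U) : Prop :=
  (∀ x ∈ W, T x ∈ W) ∧ ∀ x ∈ W, (∀ y ∈ W, ω x y = 0) → x = 0

/-- Both subspaces are invariant under `T` and isotropic for `ω`. -/
structure IsInvariantIsotropicPair (ω : U →ₗ[ℝ] U →ₗ[ℝ] ℝ) (T : U →ₗ[ℝ] U)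
    (L L' : Submodule ℝ U) : Prop where
  map_left : ∀ x ∈ L, T x ∈ L
  map_right : ∀ x ∈ L', T x ∈ L'
  isotropic_left : ∀ x ∈ L, ∀ y ∈ L, ω x y = 0
  isotropic_right : ∀ x ∈ L', ∀ y ∈ L', ω x y = 0

/-- Splitting off a dual pair of cyclic subspaces: the first one is generated by a vector `u` whose
orbit has the largest possible number `d` of linearly independent first members, the second one by
a vector `w` with `ω (T ^ i u) w = 0` for `i < d - 1` and `ω (T ^ (d - 1) u) w = 1`. -/
theorem exists_cyclic_pair [FiniteDimensional ℝ U] (hω : ∀ x, ω x x = 0)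
    (hT : ∀ x, ω (T x) x = 0) {W : Submodule ℝ U} (hW : IsNondegInvariant ω T W) (hW0 : W ≠ ⊥) :
    ∃ C C' : Submodule ℝ U, C ≤ W ∧ C' ≤ W ∧ C ≠ ⊥ ∧ IsInvariantIsotropicPair ω T C C' ∧
      (∀ x ∈ C, (∀ y ∈ C', ω x y = 0) → x = 0) ∧ (∀ y ∈ C', (∀ x ∈ C, ω x y = 0) → y = 0) := by
  obtain ⟨x, hx, hx0⟩ := Submodule.exists_mem_ne_zero_of_ne_bot hW0
  obtain ⟨d, hd, ⟨u, hu, hind⟩, hmax⟩ :=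
    exists_linearIndependent_orbit_maximal (T := T) hx hx0
  have huW := orbitSpan_le hW.1 hu d
  have hmemu : ∀ i : Fin d, (T ^ (i : ℕ)) u ∈ orbitSpan T d u :=
    fun i => Submodule.subset_span ⟨i, rfl⟩
  -- The functionals `ω (T ^ i u)` on `W` are independent because `ω` is nondegenerate on `W`.
  have hφ : LinearIndependent ℝ fun i : Fin d => (ω ((T ^ (i : ℕ)) u)).comp W.subtype := by
    rw [Fintype.linearIndependent_iff]
    intro c hc
    have h0 : ∑ i : Fin d, c i • (T ^ (i : ℕ)) u = 0 := by
      refine hW.2 _ (Submodule.sum_mem _ fun i _ => W.smul_mem _ (huW (hmemu i))) ?_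
      intro y hy
      have := LinearMap.congr_fun hc ⟨y, hy⟩
      simpa using this
    exact Fintype.linearIndependent_iff.mp hind c h0
  obtain ⟨⟨w, hw⟩, hwφ⟩ := exists_forall_apply_eq_of_linearIndependent hφ
    (fun i => if (i : ℕ) + 1 = d then 1 else 0)
  set g : ℕ → ℝ := fun k => ω ((T ^ k) u) w with hg
  have hg0 : ∀ k, k + 1 < d → g k = 0 := by
    intro k hk
    have := hwφ ⟨k, by omega⟩
    rw [if_neg (by simp; omega)] at this
    exact this
  have hg1 : g (d - 1) ≠ 0 := by
    have := hwφ ⟨d - 1, by omega⟩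
    rw [if_pos (by simp; omega)] at this
    have h2 : g (d - 1) = 1 := this
    rw [h2]; exact one_ne_zero
  have hzero_right : ∀ c : Fin d → ℝ,
      (∀ j < d, ω ((T ^ j) u) (∑ i : Fin d, c i • (T ^ (i : ℕ)) w) = 0) → c = 0 := by
    intro c hc
    refine eq_zero_of_antitriangular hg0 hg1 fun j hj => ?_
    have := hc j hj
    simp only [map_sum, map_smul, smul_eq_mul, form_pow_pow hω hT] at this
    simpa only [hg, add_comm] using this
  have hzero_left : ∀ c : Fin d → ℝ,
      (∀ j < d, ω (∑ i : Fin d, c i • (T ^ (i : ℕ)) u) ((T ^ j) w) = 0) → c = 0 := by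
    intro c hc
    refine eq_zero_of_antitriangular hg0 hg1 fun j hj => ?_
    have := hc j hj
    simpa only [map_sum, map_smul, smul_eq_mul, LinearMap.sum_apply, LinearMap.smul_apply,
      form_pow_pow hω hT] using this
  have hindw : LinearIndependent ℝ fun i : Fin d => (T ^ (i : ℕ)) w := by
    rw [Fintype.linearIndependent_iff]
    intro c hc i
    exact congrFun (hzero_right c fun j _ => by rw [hc, map_zero]) i
  have hmemw : ∀ i : Fin d, (T ^ (i : ℕ)) w ∈ orbitSpan T d w :=
    fun i => Submodule.subset_span ⟨i, rfl⟩
  refine ⟨orbitSpan T d u, orbitSpan T d w, huW, orbitSpan_le hW.1 hw d, ?_,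
    ⟨fun x hx => map_mem_orbitSpan (hmax u hu hind) hx,
      fun x hx => map_mem_orbitSpan (hmax w hw hindw) hx,
      fun x hx y hy => orbitSpan_isotropic hω hT d u hx hy,
      fun x hx y hy => orbitSpan_isotropic hω hT d w hx hy⟩, ?_, ?_⟩
  · intro hbot
    have h := hmemu ⟨0, hd⟩
    rw [hbot, Submodule.mem_bot] at h
    exact hind.ne_zero ⟨0, hd⟩ h
  · intro x hx hxy
    obtain ⟨c, rfl⟩ := (Submodule.mem_span_range_iff_exists_fun ℝ).mp hx
    have := hzero_left c fun j hj => hxy _ (hmemw ⟨j, hj⟩)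
    simp [this]
  · intro y hy hxy
    obtain ⟨c, rfl⟩ := (Submodule.mem_span_range_iff_exists_fun ℝ).mp hy
    have := hzero_right c fun j hj => hxy _ (hmemu ⟨j, hj⟩)
    simp [this]

theorem exists_lagrangian_pair_aux [FiniteDimensional ℝ U] (hω : ∀ x, ω x x = 0)
    (hT : ∀ x, ω (T x) x = 0) (N : ℕ) : ∀ W : Submodule ℝ U, Module.finrank ℝ W ≤ N →
      IsNondegInvariant ω T W →
      ∃ L L' : Submodule ℝ U, IsInvariantIsotropicPair ω T L L' ∧ L ⊔ L' = W := by
  induction N with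
  | zero =>
    intro W hdim _
    have h0 : W = ⊥ := Submodule.finrank_eq_zero.mp (by omega)
    exact ⟨⊥, ⊥, ⟨by simp, by simp, by simp, by simp⟩, by simp [h0]⟩
  | succ N ih =>
    intro W hdim hW
    by_cases hW0 : W = ⊥
    · exact ⟨⊥, ⊥, ⟨by simp, by simp, by simp, by simp⟩, by simp [hW0]⟩
    obtain ⟨C, C', hC, hC', hC0, hpair, hnl, hnr⟩ := exists_cyclic_pair hω hT hW hW0
    have hswap := form_swap hω
    set S := C ⊔ C' with hS
    have hSnd : ∀ x ∈ S, (∀ y ∈ S, ω x y = 0) → x = 0 := by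
      intro x hx hxy
      obtain ⟨c, hc, c', hc', rfl⟩ := Submodule.mem_sup.mp hx
      have h1 : c = 0 := by
        refine hnl c hc fun y hy => ?_
        have := hxy y (Submodule.mem_sup_right hy)
        rw [map_add, LinearMap.add_apply, hpair.isotropic_right c' hc' y hy, add_zero] at this
        exact this
      have h2 : c' = 0 := by
        refine hnr c' hc' fun y hy => ?_
        have := hxy y (Submodule.mem_sup_left hy)
        rw [map_add, LinearMap.add_apply, hpair.isotropic_left c hc y hy, zero_add] at this
        rw [hswap, this, neg_zero]
      simp [h1, h2]
    have hSinv : ∀ x ∈ S, T x ∈ S := by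
      intro x hx
      obtain ⟨c, hc, c', hc', rfl⟩ := Submodule.mem_sup.mp hx
      rw [map_add]
      exact Submodule.add_mem_sup (hpair.map_left c hc) (hpair.map_right c' hc')
    have hrefl : LinearMap.BilinForm.IsRefl ω := fun x y h => by rw [hswap, h, neg_zero]
    have hcompl := LinearMap.BilinForm.isCompl_orthogonal_of_restrict_nondegenerate
      (B := ω) (W := S) hrefl (by
        refine ⟨fun x hx => ?_, fun x hx => ?_⟩
        · exact Subtype.ext (hSnd x x.2 fun y hy => hx ⟨y, hy⟩)
        · exact Subtype.ext (hSnd x x.2 fun y hy => by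
            rw [hswap]; exact neg_eq_zero.mpr (hx ⟨y, hy⟩)))
    set O := LinearMap.BilinForm.orthogonal ω S with hO
    have hOmem : ∀ y, y ∈ O ↔ ∀ x ∈ S, ω x y = 0 := fun y => Iff.rfl
    have hSW : S ≤ W := sup_le hC hC'
    have hsum : S ⊔ (O ⊓ W) = W := by
      rw [← sup_inf_assoc_of_le O hSW, hcompl.sup_eq_top, top_inf_eq]
    have hdisj : S ⊓ (O ⊓ W) = ⊥ := by
      rw [← inf_assoc, hcompl.inf_eq_bot, bot_inf_eq]
    have hdimadd := Submodule.finrank_sup_add_finrank_inf_eq S (O ⊓ W)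
    rw [hsum, hdisj, finrank_bot, add_zero] at hdimadd
    have hSpos : 0 < Module.finrank ℝ S := by
      rw [Nat.pos_iff_ne_zero, Ne, Submodule.finrank_eq_zero]
      intro h
      exact hC0 (le_bot_iff.mp (h ▸ le_sup_left))
    obtain ⟨L, L', hL, hLL⟩ := ih (O ⊓ W) (by omega) (by
      refine ⟨fun x hx => ⟨?_, hW.1 x hx.2⟩, fun x hx hxy => ?_⟩
      · refine (hOmem _).mpr fun s hs => ?_
        rw [← form_map_left hω hT]
        exact (hOmem x).mp hx.1 _ (hSinv s hs)
      · refine hW.2 x hx.2 fun y hy => ?_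
        rw [← hsum] at hy
        obtain ⟨s, hs, z, hz, rfl⟩ := Submodule.mem_sup.mp hy
        rw [map_add, hxy z hz, hswap, (hOmem x).mp hx.1 s hs]
        simp)
    have hLO : L ≤ O := (le_sup_left.trans hLL.le).trans inf_le_left
    have hLO' : L' ≤ O := (le_sup_right.trans hLL.le).trans inf_le_left
    refine ⟨C ⊔ L, C' ⊔ L', ⟨?_, ?_, ?_, ?_⟩, ?_⟩
    · intro x hx
      obtain ⟨c, hc, l, hl, rfl⟩ := Submodule.mem_sup.mp hx
      rw [map_add]
      exact Submodule.add_mem_sup (hpair.map_left c hc) (hL.map_left l hl)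
    · intro x hx
      obtain ⟨c, hc, l, hl, rfl⟩ := Submodule.mem_sup.mp hx
      rw [map_add]
      exact Submodule.add_mem_sup (hpair.map_right c hc) (hL.map_right l hl)
    · intro x hx y hy
      obtain ⟨c, hc, l, hl, rfl⟩ := Submodule.mem_sup.mp hx
      obtain ⟨c', hc', l', hl', rfl⟩ := Submodule.mem_sup.mp hy
      simp only [map_add, LinearMap.add_apply]
      rw [hpair.isotropic_left c hc c' hc', hL.isotropic_left l hl l' hl',
        (hOmem l').mp (hLO hl') c (Submodule.mem_sup_left hc), hswap l c',
        (hOmem l).mp (hLO hl) c' (Submodule.mem_sup_left hc')]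
      simp
    · intro x hx y hy
      obtain ⟨c, hc, l, hl, rfl⟩ := Submodule.mem_sup.mp hx
      obtain ⟨c', hc', l', hl', rfl⟩ := Submodule.mem_sup.mp hy
      simp only [map_add, LinearMap.add_apply]
      rw [hpair.isotropic_right c hc c' hc', hL.isotropic_right l hl l' hl',
        (hOmem l').mp (hLO' hl') c (Submodule.mem_sup_right hc), hswap l c',
        (hOmem l).mp (hLO' hl) c' (Submodule.mem_sup_right hc')]
      simp
    · rw [sup_sup_sup_comm, hLL, hsum]

/-- If `ω` is a symplectic form and `ω (T x) x = 0` for all `x`, then `T` has, in a suitable basis,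
the matrix `diag(A, Aᵀ)`. The basis is made of a basis of an invariant Lagrangian subspace and of
the `ω`-dual basis of a complementary invariant Lagrangian subspace. -/
theorem exists_basis_toMatrix_eq_fromBlocks_transpose [FiniteDimensional ℝ U]
    (hω : ∀ x, ω x x = 0) (hnd : ∀ x, (∀ y, ω x y = 0) → x = 0) (hT : ∀ x, ω (T x) x = 0) :
    ∃ (k : ℕ) (A : Matrix (Fin k) (Fin k) ℝ) (b : Module.Basis (Fin k ⊕ Fin k) ℝ U),
      LinearMap.toMatrix b b T = Matrix.fromBlocks A 0 0 A.transpose := by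
  obtain ⟨L, L', hL, hsup⟩ := exists_lagrangian_pair_aux hω hT (Module.finrank ℝ U) ⊤
    (Submodule.finrank_le _) ⟨fun _ _ => trivial, fun x _ h => hnd x fun y => h y trivial⟩
  have hswap := form_swap hω
  have hnl : ∀ x ∈ L, (∀ y ∈ L', ω x y = 0) → x = 0 := by
    intro x hx h
    refine hnd x fun y => ?_
    obtain ⟨l, hl, l', hl', rfl⟩ := Submodule.mem_sup.mp (hsup ▸ trivial : y ∈ L ⊔ L')
    rw [map_add, hL.isotropic_left x hx l hl, h l' hl', add_zero]
  have hnr : ∀ y ∈ L', (∀ x ∈ L, ω x y = 0) → y = 0 := by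
    intro x hx h
    refine hnd x fun y => ?_
    obtain ⟨l, hl, l', hl', rfl⟩ := Submodule.mem_sup.mp (hsup ▸ trivial : y ∈ L ⊔ L')
    rw [map_add, hL.isotropic_right x hx l' hl', hswap, h l hl]
    simp
  let k := Module.finrank ℝ L
  let e : Module.Basis (Fin k) ℝ L := Module.finBasis ℝ L
  have hφ : LinearIndependent ℝ fun i : Fin k => (ω (e i)).comp L'.subtype := by
    rw [Fintype.linearIndependent_iff]
    intro c hc
    have h0 : ((∑ i : Fin k, c i • e i : L) : U) = 0 := by
      refine hnl _ (Subtype.mem _) ?_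
      intro y hy
      have := LinearMap.congr_fun hc ⟨y, hy⟩
      simpa using this
    exact Fintype.linearIndependent_iff.mp e.linearIndependent c (Subtype.ext h0)
  choose f hf using fun j : Fin k => exists_forall_apply_eq_of_linearIndependent hφ
    (fun i => if i = j then 1 else 0)
  have hef : ∀ i j : Fin k, ω (e i) (f j) = if i = j then 1 else 0 := fun i j => hf j i
  have hexp_right : ∀ y ∈ L', y = ∑ i, ω (e i) y • (f i : U) := by
    intro y hy
    refine sub_eq_zero.mp (hnr _ (L'.sub_mem hy (Submodule.sum_mem _ fun i _ =>
      L'.smul_mem _ (f i).2)) fun x hx => ?_)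
    have hx' : x = ∑ i, e.repr ⟨x, hx⟩ i • (e i : U) := by
      have := congrArg Subtype.val (e.sum_repr ⟨x, hx⟩)
      rw [Submodule.coe_sum] at this
      exact this.symm
    rw [hx', map_sum, LinearMap.sum_apply]
    refine Finset.sum_eq_zero fun i _ => ?_
    simp [map_sum, hef]
  have hexp_left : ∀ x ∈ L, x = ∑ i, ω x (f i) • (e i : U) := by
    intro x hx
    have hx' : x = ∑ i, e.repr ⟨x, hx⟩ i • (e i : U) := by
      have := congrArg Subtype.val (e.sum_repr ⟨x, hx⟩)
      rw [Submodule.coe_sum] at this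
      exact this.symm
    have hc : ∀ j, ω x (f j) = e.repr ⟨x, hx⟩ j := by
      intro j
      conv_lhs => rw [hx']
      simp [map_sum, LinearMap.sum_apply, hef]
    simp only [hc]
    exact hx'
  let v : Fin k ⊕ Fin k → U := Sum.elim (fun i => (e i : U)) (fun i => (f i : U))
  have hind : LinearIndependent ℝ v := by
    rw [Fintype.linearIndependent_iff]
    intro c hc
    simp only [Fintype.sum_sum_type, v, Sum.elim_inl, Sum.elim_inr] at hc
    rintro (j | j)
    · have := congrArg (fun z => ω z (f j)) hc
      simpa [map_sum, LinearMap.sum_apply, hef, hL.isotropic_right _ (f _).2 _ (f j).2] using this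
    · have := congrArg (fun z => ω (e j) z) hc
      simpa [map_sum, LinearMap.sum_apply, hef, hL.isotropic_left _ (e j).2 _ (e _).2] using this
  have hspan : ⊤ ≤ Submodule.span ℝ (Set.range v) := by
    rw [← hsup, sup_le_iff]
    constructor
    · intro x hx
      rw [hexp_left x hx]
      exact Submodule.sum_mem _ fun i _ =>
        Submodule.smul_mem _ _ (Submodule.subset_span ⟨Sum.inl i, rfl⟩)
    · intro x hx
      rw [hexp_right x hx]
      exact Submodule.sum_mem _ fun i _ =>
        Submodule.smul_mem _ _ (Submodule.subset_span ⟨Sum.inr i, rfl⟩)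
  let b := Module.Basis.mk hind hspan
  have hbv : ∀ s, b s = v s := fun s => by simp [b]
  refine ⟨k, Matrix.of fun i j => ω (T (e j)) (f i), b, ?_⟩
  have hcol_left : ∀ j, T (b (Sum.inl j)) = ∑ i, ω (T (e j)) (f i) • b (Sum.inl i) := by
    intro j
    simp only [hbv, v, Sum.elim_inl]
    exact hexp_left _ (hL.map_left _ (e j).2)
  have hcol_right : ∀ j, T (b (Sum.inr j)) = ∑ i, ω (T (e i)) (f j) • b (Sum.inr i) := by
    intro j
    simp only [hbv, v, Sum.elim_inr, form_map_left hω hT]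
    exact hexp_right _ (hL.map_right _ (f j).2)
  ext s t
  rw [LinearMap.toMatrix_apply]
  rcases t with j | j <;> rcases s with i | i
  all_goals
    first
      | rw [hcol_left]
      | rw [hcol_right]
    simp [map_sum, Finsupp.single_apply]

end Symplectic

/-! ### The pairing between polygons and dual polygons -/

section Pairing

variable {n m : ℕ}

theorem sum_comp_add_one {M : Type*} [AddCommMonoid M] [NeZero n] (f : ZMod n → M) :
    ∑ j, f (j + 1) = ∑ j, f j :=
  Equiv.sum_comp (Equiv.addRight (1 : ZMod n)) f

theorem eq_const_of_add_one [NeZero n] {α : Type*} {f : ZMod n → α} (h : ∀ j, f (j + 1) = f j)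
    (j : ZMod n) : f j = f 0 := by
  have hk : ∀ k : ℕ, f (k : ZMod n) = f 0 := by
    intro k
    induction k with
    | zero => simp
    | succ k ih => rw [Nat.cast_succ, h, ih]
  simpa using hk j.val

/-- The vertices `Q i` determined by the equations `⟪v j, Q i⟫ = h j` for `j = i, …, i + m - 1`:
the intersection points of `m` consecutive hyperplanes with normals `v j` and heights `h j`. -/
noncomputable def hyperplaneVertices (v : ZMod n → Vec m) :
    (ZMod n → ℝ) →ₗ[ℝ] (ZMod n → Vec m) where
  toFun h i := WithLp.toLp 2 ((rowMatrix v i)⁻¹.mulVec fun r : Fin m => h (i + ((r : ℕ) : ZMod n)))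
  map_add' h k := by
    funext i
    simp only [Pi.add_apply, ← WithLp.toLp_add, ← Matrix.mulVec_add]
    rfl
  map_smul' a h := by
    funext i
    simp only [Pi.smul_apply, RingHom.id_apply, ← WithLp.toLp_smul, ← Matrix.mulVec_smul]
    rfl

theorem inner_hyperplaneVertices {v : ZMod n → Vec m} (hv : IsGeneric v) (h : ZMod n → ℝ)
    (i : ZMod n) (r : Fin m) :
    inner ℝ (v (i + ((r : ℕ) : ZMod n))) (hyperplaneVertices v h i) =
      h (i + ((r : ℕ) : ZMod n)) := by
  rw [inner_eq_rowMatrix_mulVec]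
  simp only [hyperplaneVertices, LinearMap.coe_mk, AddHom.coe_mk]
  rw [Matrix.mulVec_mulVec, Matrix.mul_nonsing_inv _ (det_rowMatrix_ne_zero hv i).isUnit,
    Matrix.one_mulVec]

theorem inner_hyperplaneVertices_self [NeZero m] {v : ZMod n → Vec m} (hv : IsGeneric v)
    (h : ZMod n → ℝ) (i : ZMod n) : inner ℝ (v i) (hyperplaneVertices v h i) = h i := by
  simpa using inner_hyperplaneVertices hv h i 0

theorem hyperplaneVertices_mem_dual [NeZero m] {v : ZMod n → Vec m} (hv : IsGeneric v)
    (h : ZMod n → ℝ) : hyperplaneVertices v h ∈ polygons (dualPolygon v) := by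
  intro i
  refine mem_span_of_inner hv (i + 1) (dualPolygon_ne_zero hv i)
    (inner_dualPolygon_eq_zero v i) fun r hr => ?_
  have h1 := inner_hyperplaneVertices hv h (i + 1) ⟨r, by omega⟩
  have h2 := inner_hyperplaneVertices hv h i ⟨r + 1, hr⟩
  have e : i + ((r + 1 : ℕ) : ZMod n) = i + 1 + (r : ZMod n) := by push_cast; ring
  simp only [e] at h1 h2
  rw [inner_sub_right, h1, h2, sub_self]

/-- The evolute is the polygon cut out by the perpendicular bisectors of the sides. -/
theorem evoluteVertices_zero (v P : ZMod n → Vec m) :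
    evoluteVertices v 0 P =
      hyperplaneVertices v fun j => inner ℝ (v j) (midpoint ℝ (P j) (P (j + 1))) := by
  funext i
  simp only [evoluteVertices, LinearMap.coe_mk, AddHom.coe_mk, sub_zero]
  rfl

/-- The form `∑ j, ⟪Q j, P (j + 1) - P j⟫`. -/
noncomputable def vertexPairing [NeZero n] :
    (ZMod n → Vec m) →ₗ[ℝ] (ZMod n → Vec m) →ₗ[ℝ] ℝ :=
  LinearMap.mk₂ ℝ (fun Q P => ∑ j, inner ℝ (Q j) (P (j + 1) - P j))
    (fun Q Q' P => by simp only [Pi.add_apply, inner_add_left, Finset.sum_add_distrib])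
    (fun c Q P => by simp only [Pi.smul_apply, real_inner_smul_left, smul_eq_mul, Finset.mul_sum])
    (fun Q P P' => by
      simp only [Pi.add_apply, ← Finset.sum_add_distrib, ← inner_add_right]
      refine Finset.sum_congr rfl fun j _ => ?_
      congr 1
      abel)
    (fun c Q P => by
      simp only [Pi.smul_apply, ← smul_sub, real_inner_smul_right, smul_eq_mul, Finset.mul_sum])

theorem vertexPairing_apply [NeZero n] (Q P : ZMod n → Vec m) :
    vertexPairing Q P = ∑ j, inner ℝ (Q j) (P (j + 1) - P j) := rfl

theorem vertexPairing_translation_left [NeZero n] {Q : ZMod n → Vec m}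
    (hQ : Q ∈ translations n m) (P : ZMod n → Vec m) : vertexPairing Q P = 0 := by
  obtain ⟨q, rfl⟩ := hQ
  simp only [vertexPairing_apply, LinearMap.pi_apply, LinearMap.id_apply, inner_sub_right,
    Finset.sum_sub_distrib]
  rw [sum_comp_add_one fun j => inner ℝ q (P j), sub_self]

theorem vertexPairing_translation_right [NeZero n] (Q : ZMod n → Vec m) {P : ZMod n → Vec m}
    (hP : P ∈ translations n m) : vertexPairing Q P = 0 := by
  obtain ⟨p, rfl⟩ := hP
  simp [vertexPairing_apply]

/-- Summation by parts. -/
theorem vertexPairing_eq_neg_sum [NeZero n] (Q P : ZMod n → Vec m) :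
    vertexPairing Q P = -∑ j, inner ℝ (Q (j + 1) - Q j) (P (j + 1)) := by
  simp only [vertexPairing_apply, inner_sub_right, inner_sub_left, Finset.sum_sub_distrib]
  rw [← sum_comp_add_one fun j => inner ℝ (Q j) (P j)]
  ring

theorem inner_of_mem_span {x y z w : Vec m} (h : x ∈ Submodule.span ℝ {w})
    (hw : inner ℝ w y = inner ℝ w z) : inner ℝ x y = inner ℝ x z := by
  obtain ⟨c, rfl⟩ := Submodule.mem_span_singleton.mp h
  rw [real_inner_smul_left, real_inner_smul_left, hw]

/-- Pairing the evolute of `P` with `P` gives zero: the evolute may be replaced by the midpoints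
of the sides, and then the sum telescopes. -/
theorem vertexPairing_evoluteVertices_self [NeZero n] [NeZero m] {v : ZMod n → Vec m}
    (hv : IsGeneric v) {P : ZMod n → Vec m} (hP : P ∈ polygons v) :
    vertexPairing (evoluteVertices v 0 P) P = 0 := by
  have h : ∀ j, inner ℝ (evoluteVertices v 0 P j) (P (j + 1) - P j) =
      (1 / 2 : ℝ) * (inner ℝ (P (j + 1)) (P (j + 1)) - inner ℝ (P j) (P j)) := by
    intro j
    rw [real_inner_comm, evoluteVertices_zero, inner_of_mem_span (hP j)
      (inner_hyperplaneVertices_self hv _ j), midpoint_eq_smul_add]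
    simp only [inner_smul_right, inner_add_right, inner_sub_left, real_inner_comm (P (j + 1)) (P j)]
    rw [invOf_eq_inv]
    ring
  rw [vertexPairing_apply, Finset.sum_congr rfl fun j _ => h j, ← Finset.mul_sum,
    Finset.sum_sub_distrib, sum_comp_add_one fun j => inner ℝ (P j) (P j), sub_self, mul_zero]

/-- The pairing of `Q` with the evolute of `Q'` is the mixed signed area of `Q` and `Q'`. -/
theorem vertexPairing_evoluteVertices_dual [NeZero n] [NeZero m] {v : ZMod n → Vec m}
    (hv : IsGeneric v) {Q : ZMod n → Vec m} (hQ : Q ∈ polygons (dualPolygon v))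
    (Q' : ZMod n → Vec m) :
    vertexPairing Q (evoluteVertices (dualPolygon v) (m : ZMod n) Q') =
      (1 / 2 : ℝ) * ∑ j, (inner ℝ (Q j) (Q' (j + 1)) - inner ℝ (Q (j + 1)) (Q' j)) := by
  have h : ∀ j, inner ℝ (Q (j + 1) - Q j)
      (evoluteVertices (dualPolygon v) (m : ZMod n) Q' (j + 1)) =
      (1 / 2 : ℝ) * (inner ℝ (Q (j + 1)) (Q' (j + 1)) - inner ℝ (Q j) (Q' j)) -
      (1 / 2 : ℝ) * (inner ℝ (Q j) (Q' (j + 1)) - inner ℝ (Q (j + 1)) (Q' j)) := by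
    intro j
    have hlast := inner_evoluteVertex (isGeneric_dualPolygon hv) Q' (j + 1 - (m : ZMod n))
      (Fin.rev 0)
    have e : j + 1 - (m : ZMod n) + (((Fin.rev (0 : Fin m)) : ℕ) : ZMod n) = j := by
      have hm := NeZero.pos m
      have h1 : m = 1 + ((Fin.rev (0 : Fin m)) : ℕ) := by simp; omega
      have h2 := congrArg (Nat.cast : ℕ → ZMod n) h1
      push_cast at h2
      linear_combination -h2
    rw [e] at hlast
    have hR : evoluteVertices (dualPolygon v) (m : ZMod n) Q' (j + 1) =
        evoluteVertex (dualPolygon v) Q' (j + 1 - (m : ZMod n)) := rfl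
    rw [hR, inner_of_mem_span (hQ j) hlast, midpoint_eq_smul_add]
    simp only [inner_smul_right, inner_add_right, inner_sub_left]
    rw [invOf_eq_inv]
    ring
  rw [vertexPairing_eq_neg_sum, Finset.sum_congr rfl fun j _ => h j, Finset.sum_sub_distrib,
    ← Finset.mul_sum, ← Finset.mul_sum, Finset.sum_sub_distrib,
    sum_comp_add_one fun j => inner ℝ (Q j) (Q' j)]
  ring

/-- The pairing between classes of polygons with sides along `v^*` and along `v`; it makes
`P_{v^*}` the dual space of `P_v`. -/
noncomputable def polygonPairing [NeZero n] [NeZero m] (v : ZMod n → Vec m) :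
    PolygonSpace (dualPolygon v) →ₗ[ℝ] PolygonSpace v →ₗ[ℝ] ℝ :=
  (Submodule.liftQ ((translations n m).submoduleOf (polygons v))
    (Submodule.liftQ ((translations n m).submoduleOf (polygons (dualPolygon v)))
      (vertexPairing.compl₁₂ (polygons (dualPolygon v)).subtype (polygons v).subtype)
      (fun _ hQ => LinearMap.ext fun P => vertexPairing_translation_left hQ P)).flip
    (fun _ hP => LinearMap.ext fun Q => by
      obtain ⟨Q, rfl⟩ := Submodule.Quotient.mk_surjective _ Q
      exact vertexPairing_translation_right _ hP)).flip

theorem polygonPairing_mk [NeZero n] [NeZero m] (v : ZMod n → Vec m)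
    (Q : polygons (dualPolygon v)) (P : polygons v) :
    polygonPairing v (Submodule.Quotient.mk Q) (Submodule.Quotient.mk P) =
      vertexPairing (Q : ZMod n → Vec m) (P : ZMod n → Vec m) := rfl

variable [NeZero m] {v : ZMod n → Vec m} (hv : IsGeneric v)

/-- The class of the polygon `hyperplaneVertices v h` in `P_{v^*}`. -/
noncomputable def supportClass : (ZMod n → ℝ) →ₗ[ℝ] PolygonSpace (dualPolygon v) :=
  (Submodule.mkQ _).comp
    ((hyperplaneVertices v).codRestrict _ (hyperplaneVertices_mem_dual hv))

theorem supportClass_apply (h : ZMod n → ℝ) :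
    supportClass hv h = Submodule.Quotient.mk
      ⟨hyperplaneVertices v h, hyperplaneVertices_mem_dual hv h⟩ := rfl

theorem evolute_mk (P : polygons v) :
    evolute v hv (Submodule.Quotient.mk P) = Submodule.Quotient.mk
      ⟨evoluteVertices v 0 P, evoluteVertices_mem_dual hv P⟩ := rfl

variable [NeZero n]

/-- The signed side lengths, in units of the `v j`, of a polygon with sides along `v`. -/
noncomputable def sideLengths : PolygonSpace v →ₗ[ℝ] (ZMod n → ℝ) :=
  LinearMap.pi fun j => polygonPairing v (supportClass hv (Pi.single j 1))

theorem polygonPairing_supportClass (h : ZMod n → ℝ) (P : polygons v) {l : ZMod n → ℝ}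
    (hl : ∀ j, (P : ZMod n → Vec m) (j + 1) - (P : ZMod n → Vec m) j = l j • v j) :
    polygonPairing v (supportClass hv h) (Submodule.Quotient.mk P) = ∑ j, l j * h j := by
  rw [supportClass_apply, polygonPairing_mk, vertexPairing_apply]
  refine Finset.sum_congr rfl fun j _ => ?_
  rw [hl, real_inner_smul_right, real_inner_comm]
  simp only [inner_hyperplaneVertices_self hv]

theorem sideLengths_mk (P : polygons v) (j : ZMod n) :
    (P : ZMod n → Vec m) (j + 1) - (P : ZMod n → Vec m) j =
      sideLengths hv (Submodule.Quotient.mk P) j • v j := by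
  choose l hl using fun j => Submodule.mem_span_singleton.mp (P.2 j)
  have h := polygonPairing_supportClass hv (Pi.single j 1) P fun j => (hl j).symm
  have e : sideLengths hv (Submodule.Quotient.mk P) j = l j := by
    rw [sideLengths, LinearMap.pi_apply, h]
    simp [Pi.single_apply]
  rw [e, hl]

theorem sideLengths_injective : Function.Injective (sideLengths hv) := by
  rw [← LinearMap.ker_eq_bot, LinearMap.ker_eq_bot']
  intro x hx
  obtain ⟨P, rfl⟩ := Submodule.Quotient.mk_surjective _ x
  rw [Submodule.Quotient.mk_eq_zero]
  refine ⟨(P : ZMod n → Vec m) 0, ?_⟩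
  funext j
  have h : ∀ j, (P : ZMod n → Vec m) (j + 1) = (P : ZMod n → Vec m) j := by
    intro j
    have := sideLengths_mk hv P j
    rw [hx] at this
    simpa [sub_eq_zero] using this
  exact (eq_const_of_add_one h j).symm

/-- The pairing with the class of `hyperplaneVertices v h`, for `h` supported at one index, is a
side length. -/
theorem polygonPairing_nondegenerate {v : ZMod n → Vec m} (hv : IsGeneric v) {x : PolygonSpace v}
    (h : ∀ y, polygonPairing v y x = 0) : x = 0 := by
  refine sideLengths_injective hv ?_
  rw [map_zero]
  funext j
  exact h _

theorem polygonPairing_evolute_self (x : PolygonSpace v) :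
    polygonPairing v (evolute v hv x) x = 0 := by
  obtain ⟨P, rfl⟩ := Submodule.Quotient.mk_surjective _ x
  exact vertexPairing_evoluteVertices_self hv P.2

theorem polygonPairing_evoluteOfDual_mk (Q Q' : polygons (dualPolygon v)) :
    polygonPairing v (Submodule.Quotient.mk Q) (evoluteOfDual v hv (Submodule.Quotient.mk Q')) =
      (1 / 2 : ℝ) * ∑ j, (inner ℝ ((Q : ZMod n → Vec m) j) ((Q' : ZMod n → Vec m) (j + 1)) -
        inner ℝ ((Q : ZMod n → Vec m) (j + 1)) ((Q' : ZMod n → Vec m) j)) :=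
  vertexPairing_evoluteVertices_dual hv Q.2 _

theorem polygonPairing_evoluteOfDual_swap (x y : PolygonSpace (dualPolygon v)) :
    polygonPairing v x (evoluteOfDual v hv y) = -polygonPairing v y (evoluteOfDual v hv x) := by
  obtain ⟨Q, rfl⟩ := Submodule.Quotient.mk_surjective _ x
  obtain ⟨Q', rfl⟩ := Submodule.Quotient.mk_surjective _ y
  rw [polygonPairing_evoluteOfDual_mk, polygonPairing_evoluteOfDual_mk, ← mul_neg,
    ← Finset.sum_neg_distrib]
  congr 1
  refine Finset.sum_congr rfl fun j _ => ?_
  rw [real_inner_comm, real_inner_comm ((Q : ZMod n → Vec m) (j + 1))]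
  ring

/-! ### The block form on the image and the evenness of multiplicities -/

/-- The evolute map `P_{v^*} → P_v` as a map onto its image. -/
noncomputable def evoluteOntoImage :
    PolygonSpace (dualPolygon v) →ₗ[ℝ] ↥(evoluteImage v hv) :=
  (evoluteOfDual v hv).codRestrict _ fun x => ⟨x, rfl⟩

/-- The image of the evolute map carries the symplectic form `ω (E y) x = ⟨y, x⟩`, for which `E²`
is self-adjoint. -/
theorem exists_basis_secondEvoluteOnImage :
    ∃ (k : ℕ) (A : Matrix (Fin k) (Fin k) ℝ)
      (b : Module.Basis (Fin k ⊕ Fin k) ℝ (evoluteImage v hv)),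
      LinearMap.toMatrix b b (secondEvoluteOnImage v hv) =
        Matrix.fromBlocks A 0 0 A.transpose := by
  obtain ⟨s, hs⟩ := (evoluteOntoImage hv).exists_rightInverse_of_surjective (by
      rw [LinearMap.range_eq_top]
      rintro ⟨_, x, rfl⟩
      exact ⟨x, rfl⟩)
  have hs' : ∀ u : evoluteImage v hv, evoluteOfDual v hv (s u) = u :=
    fun u => congrArg Subtype.val (LinearMap.congr_fun hs u)
  have hswap := polygonPairing_evoluteOfDual_swap hv
  refine exists_basis_toMatrix_eq_fromBlocks_transpose
    (ω := (polygonPairing v).compl₁₂ s (evoluteImage v hv).subtype) ?_ ?_ ?_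
  · intro u
    have h := hswap (s u) (s u)
    rw [hs'] at h
    simp only [LinearMap.compl₁₂_apply, Submodule.subtype_apply]
    linarith
  · intro u hu
    refine Subtype.ext (polygonPairing_nondegenerate hv fun y => ?_)
    have h : polygonPairing v (s u) (evoluteOfDual v hv y) = 0 :=
      hu ⟨evoluteOfDual v hv y, y, rfl⟩
    rw [hswap, hs', neg_eq_zero] at h
    exact h
  · intro u
    have h1 : ((secondEvoluteOnImage v hv u : evoluteImage v hv) : PolygonSpace v) =
      evoluteOfDual v hv (evolute v hv u) := rfl
    have h2 := hswap (s (secondEvoluteOnImage v hv u)) (s u)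
    have h3 := hswap (s u) (evolute v hv u)
    rw [hs', hs', h1, h3, hs', polygonPairing_evolute_self] at h2
    simpa using h2

theorem X_pow_mul_charpoly_comp_comm {V U : Type*} [AddCommGroup V] [Module ℝ V]
    [FiniteDimensional ℝ V] [AddCommGroup U] [Module ℝ U] [FiniteDimensional ℝ U]
    (f : V →ₗ[ℝ] U) (g : U →ₗ[ℝ] V) :
    Polynomial.X ^ Module.finrank ℝ U * (g ∘ₗ f).charpoly =
      Polynomial.X ^ Module.finrank ℝ V * (f ∘ₗ g).charpoly := by
  let b := Module.finBasis ℝ V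
  let c := Module.finBasis ℝ U
  have h := Matrix.charpoly_mul_comm' (LinearMap.toMatrix c b g) (LinearMap.toMatrix b c f)
  rw [← LinearMap.toMatrix_comp, ← LinearMap.toMatrix_comp, LinearMap.charpoly_toMatrix,
    LinearMap.charpoly_toMatrix, Fintype.card_fin, Fintype.card_fin] at h
  exact h

/-- `E²` maps `P_v` into the image of `E`, so its characteristic polynomial agrees, up to powers of
`X`, with that of its restriction, which is `A.charpoly ^ 2`. -/
theorem even_eigenvalueMultiplicity {μ : ℂ} (hμ : μ ≠ 0) :
    Even (eigenvalueMultiplicity v hv μ) := by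
  obtain ⟨k, A, b, hb⟩ := exists_basis_secondEvoluteOnImage hv
  have h1 := X_pow_mul_charpoly_comp_comm
    (evoluteOntoImage hv ∘ₗ evolute v hv) (evoluteImage v hv).subtype
  have e1 : (evoluteImage v hv).subtype ∘ₗ evoluteOntoImage hv ∘ₗ evolute v hv =
    secondEvolute v hv := rfl
  have e2 : (evoluteOntoImage hv ∘ₗ evolute v hv) ∘ₗ (evoluteImage v hv).subtype =
    secondEvoluteOnImage v hv := rfl
  have h2 : (secondEvoluteOnImage v hv).charpoly = A.charpoly * A.charpoly := by
    rw [← LinearMap.charpoly_toMatrix _ b, hb, Matrix.charpoly_fromBlocks_zero₁₂,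
      Matrix.charpoly_transpose]
  rw [e1, e2, h2] at h1
  have h3 := congrArg (fun p => (p.map (algebraMap ℝ ℂ)).rootMultiplicity μ) h1
  simp only [Polynomial.map_mul, Polynomial.map_pow, Polynomial.map_X] at h3
  have hX : ∀ k : ℕ, (Polynomial.X ^ k : Polynomial ℂ).rootMultiplicity μ = 0 := by
    intro k
    refine Polynomial.rootMultiplicity_eq_zero ?_
    simp [Polynomial.IsRoot, hμ]
  have hA0 : A.charpoly.map (algebraMap ℝ ℂ) ≠ 0 :=
    ((Matrix.charpoly_monic A).map _).ne_zero
  have hS0 : (secondEvolute v hv).charpoly.map (algebraMap ℝ ℂ) ≠ 0 :=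
    ((LinearMap.charpoly_monic _).map _).ne_zero
  have hX0 : ∀ k : ℕ, (Polynomial.X ^ k : Polynomial ℂ) ≠ 0 := fun k =>
    pow_ne_zero _ Polynomial.X_ne_zero
  rw [Polynomial.rootMultiplicity_mul (mul_ne_zero (hX0 _) hS0),
    Polynomial.rootMultiplicity_mul (mul_ne_zero (hX0 _) (mul_ne_zero hA0 hA0)),
    Polynomial.rootMultiplicity_mul (mul_ne_zero hA0 hA0), hX, hX, zero_add, zero_add] at h3
  exact ⟨_, h3⟩

/-- The side lengths satisfy the `m` independent closing equations. -/
theorem finrank_polygonSpace_le {v : ZMod n → Vec m} (hv : IsGeneric v) :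
    Module.finrank ℝ (PolygonSpace v) ≤ n - m := by
  let g : (ZMod n → ℝ) →ₗ[ℝ] Vec m := ∑ j, (LinearMap.proj j).smulRight (v j)
  have hg : ∀ l, g l = ∑ j, l j • v j := fun l => by simp [g]
  have hker : ∀ x, sideLengths hv x ∈ LinearMap.ker g := by
    intro x
    obtain ⟨P, rfl⟩ := Submodule.Quotient.mk_surjective _ x
    rw [LinearMap.mem_ker, hg]
    simp only [← sideLengths_mk]
    rw [Finset.sum_sub_distrib, sum_comp_add_one fun j => (P : ZMod n → Vec m) j, sub_self]
  have hsurj : LinearMap.range g = ⊤ := by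
    have hspan := (hv 0).span_eq_top_of_card_eq_finrank (by simp)
    rw [eq_top_iff, ← hspan, Submodule.span_le]
    rintro _ ⟨r, rfl⟩
    refine ⟨Pi.single (0 + ((r : ℕ) : ZMod n)) 1, ?_⟩
    rw [hg]
    simp [Pi.single_apply]
  have h1 := LinearMap.finrank_range_add_finrank_ker g
  rw [hsurj, finrank_top] at h1
  have h2 := LinearMap.finrank_le_finrank_of_injective
    (f := (sideLengths hv).codRestrict (LinearMap.ker g) hker)
    (fun x y h => sideLengths_injective hv (congrArg Subtype.val h))
  simp at h1
  omega

end Pairing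

/-! ### Hankel determinants of power traces -/

section Hankel

open Polynomial

theorem multiset_prod_dvd_pow_card {R : Type*} [CommMonoid R] {q : R} (s : Multiset R)
    (h : ∀ a ∈ s, a ∣ q) : s.prod ∣ q ^ Multiset.card s := by
  induction s using Multiset.induction with
  | empty => simp
  | cons a s ih =>
    rw [Multiset.prod_cons, Multiset.card_cons, pow_succ']
    exact mul_dvd_mul (h a (Multiset.mem_cons_self a s))
      (ih fun b hb => h b (Multiset.mem_cons_of_mem hb))

/-- The Hankel matrix of the traces of the powers `M, M ^ 2, …, M ^ (2 * r - 1)`. -/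
def hankelTrace {R ι : Type*} [CommRing R] [Fintype ι] [DecidableEq ι] (M : Matrix ι ι R) (r : ℕ) :
    Matrix (Fin r) (Fin r) R :=
  Matrix.of fun i j => (M ^ ((i : ℕ) + j + 1)).trace

theorem hankelTrace_map {R S ι : Type*} [CommRing R] [CommRing S] [Fintype ι] [DecidableEq ι]
    (f : R →+* S) (M : Matrix ι ι R) (r : ℕ) :
    hankelTrace (f.mapMatrix M) r = f.mapMatrix (hankelTrace M r) := by
  ext i j
  simp only [hankelTrace, Matrix.of_apply, ← map_pow]
  simp [Matrix.trace, map_sum]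

theorem det_hankelTrace_map {R S ι : Type*} [CommRing R] [CommRing S] [Fintype ι] [DecidableEq ι]
    (f : R →+* S) (M : Matrix ι ι R) (r : ℕ) :
    (hankelTrace (f.mapMatrix M) r).det = f (hankelTrace M r).det := by
  rw [hankelTrace_map, RingHom.map_det]

/-- If a polynomial vanishes at all eigenvalues of `M`, its value at `M` is nilpotent. -/
theorem trace_aeval_eq_zero {ι : Type*} [Fintype ι] [DecidableEq ι] (M : Matrix ι ι ℂ) {q : ℂ[X]}
    (hq : ∀ z ∈ M.charpoly.roots, q.IsRoot z) : (aeval M q).trace = 0 := by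
  have hsplit := (IsAlgClosed.splits M.charpoly).eq_prod_roots_of_monic (Matrix.charpoly_monic M)
  have hdvd : M.charpoly ∣ q ^ Multiset.card M.charpoly.roots := by
    rw [hsplit]
    have h := multiset_prod_dvd_pow_card (q := q) (M.charpoly.roots.map fun a => X - C a) (by
      intro a ha
      obtain ⟨z, hz, rfl⟩ := Multiset.mem_map.mp ha
      exact dvd_iff_isRoot.mpr (hq z hz))
    rw [Multiset.card_map] at h
    rw [← hsplit]
    rw [← hsplit] at h
    exact h
  have hnil : IsNilpotent (aeval M q) := by
    refine ⟨Multiset.card M.charpoly.roots, ?_⟩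
    obtain ⟨w, hw⟩ := hdvd
    rw [← map_pow, hw, map_mul, Matrix.aeval_self_charpoly, zero_mul]
  exact (Matrix.isNilpotent_trace_of_isNilpotent hnil).eq_zero

/-- If the Hankel determinant of size `r` does not vanish, then there are at least `r` distinct
nonzero eigenvalues: otherwise the coefficients of `∏ (X - z)`, the product taken over the distinct
nonzero eigenvalues, are a linear relation between the rows of the Hankel matrix. -/
theorem le_card_roots_of_det_hankelTrace_ne_zero {ι : Type*} [Fintype ι] [DecidableEq ι]
    (M : Matrix ι ι ℂ) {r : ℕ} (h : (hankelTrace M r).det ≠ 0) :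
    r ≤ (M.charpoly.roots.toFinset.erase 0).card := by
  by_contra hlt
  push Not at hlt
  set S := M.charpoly.roots.toFinset.erase 0 with hS
  set p : ℂ[X] := ∏ z ∈ S, (X - C z) with hp
  have hdeg : p.natDegree = S.card := natDegree_finsetProd_X_sub_C_eq_card _ fun z : ℂ => z
  have hmon : p.Monic := monic_prod_of_monic _ _ fun z _ => monic_X_sub_C z
  refine h (Matrix.exists_vecMul_eq_zero_iff.mp ⟨fun i : Fin r => p.coeff i, ?_, ?_⟩)
  · intro h0
    have h1 := congrFun h0 ⟨S.card, hlt⟩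
    simp only [Pi.zero_apply] at h1
    rw [← hdeg, hmon.coeff_natDegree] at h1
    exact one_ne_zero h1
  · funext j
    have hq : (aeval M (X ^ ((j : ℕ) + 1) * p)).trace = 0 := by
      refine trace_aeval_eq_zero M fun z hz => ?_
      by_cases hz0 : z = 0
      · simp [hz0, IsRoot]
      · have : z ∈ S := Finset.mem_erase.mpr ⟨hz0, Multiset.mem_toFinset.mpr hz⟩
        rw [IsRoot, eval_mul, hp, eval_prod, Finset.prod_eq_zero this (by simp), mul_zero]
    rw [aeval_eq_sum_range' (n := j + 1 + r) (lt_of_le_of_lt natDegree_mul_le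
      (by rw [natDegree_X_pow, hdeg]; omega)), Matrix.trace_sum, Finset.sum_range_add] at hq
    rw [Finset.sum_eq_zero, zero_add] at hq
    · rw [Pi.zero_apply, ← hq, Finset.sum_range]
      simp only [Matrix.vecMul, dotProduct, hankelTrace, Matrix.of_apply]
      refine Finset.sum_congr rfl fun i _ => ?_
      rw [Matrix.trace_smul, smul_eq_mul, add_comm ((j : ℕ) + 1) (i : ℕ), coeff_X_pow_mul]
      congr 3
    · intro k hk
      rw [coeff_X_pow_mul', if_neg (by have := Finset.mem_range.mp hk; omega), zero_smul,
        Matrix.trace_zero]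

/-- If all nonzero eigenvalues have even multiplicity, the dimension is at most `N` and there are
at least `N / 2` distinct nonzero eigenvalues, then the multiplicities are all equal to `2`. -/
theorem rootMultiplicity_eq_two {V : Type*} [AddCommGroup V] [Module ℝ V] [FiniteDimensional ℝ V]
    (T : V →ₗ[ℝ] V) {N : ℕ} (hN : Module.finrank ℝ V ≤ N)
    (heven : ∀ μ : ℂ, μ ≠ 0 → Even ((T.charpoly.map (algebraMap ℝ ℂ)).rootMultiplicity μ))
    (h : (Matrix.of fun i j : Fin (N / 2) =>
      LinearMap.trace ℝ V (T ^ ((i : ℕ) + j + 1))).det ≠ 0)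
    {μ : ℂ} (hμ : μ ≠ 0) (hμ0 : (T.charpoly.map (algebraMap ℝ ℂ)).rootMultiplicity μ ≠ 0) :
    (T.charpoly.map (algebraMap ℝ ℂ)).rootMultiplicity μ = 2 := by
  let b := Module.finBasis ℝ V
  set A := LinearMap.toMatrix b b T with hA
  set M : Matrix _ _ ℂ := (algebraMap ℝ ℂ).mapMatrix A with hM
  have hchar : T.charpoly.map (algebraMap ℝ ℂ) = M.charpoly := by
    rw [hM, RingHom.mapMatrix_apply, Matrix.charpoly_map, hA, LinearMap.charpoly_toMatrix]
  rw [hchar] at heven hμ0 ⊢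
  have hH : (Matrix.of fun i j : Fin (N / 2) => LinearMap.trace ℝ V (T ^ ((i : ℕ) + j + 1))) =
      hankelTrace A (N / 2) := by
    ext i j
    rw [hankelTrace, Matrix.of_apply, Matrix.of_apply, LinearMap.trace_eq_matrix_trace ℝ b, hA,
      LinearMap.toMatrix_pow]
  rw [hH] at h
  have hdet : (hankelTrace M (N / 2)).det ≠ 0 := by
    rw [hM, det_hankelTrace_map]
    exact fun h0 => h ((map_eq_zero _).mp h0)
  have hr := le_card_roots_of_det_hankelTrace_ne_zero M hdet
  set S := M.charpoly.roots.toFinset.erase 0 with hS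
  have hcount : ∀ z ∈ S, 2 ≤ M.charpoly.rootMultiplicity z := by
    intro z hz
    obtain ⟨hz0, hz1⟩ := Finset.mem_erase.mp hz
    have h1 : 0 < M.charpoly.roots.count z :=
      Multiset.count_pos.mpr (Multiset.mem_toFinset.mp hz1)
    rw [count_roots] at h1
    obtain ⟨k, hk⟩ := heven z hz0
    omega
  have hμS : μ ∈ S := by
    refine Finset.mem_erase.mpr ⟨hμ, Multiset.mem_toFinset.mpr ?_⟩
    rw [← Multiset.count_pos, count_roots]
    omega
  have hsum : ∑ z ∈ S, M.charpoly.rootMultiplicity z ≤ Module.finrank ℝ V := by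
    calc ∑ z ∈ S, M.charpoly.rootMultiplicity z
        = ∑ z ∈ S, M.charpoly.roots.count z := by simp only [count_roots]
      _ ≤ ∑ z ∈ M.charpoly.roots.toFinset, M.charpoly.roots.count z :=
          Finset.sum_le_sum_of_subset (Finset.erase_subset _ _)
      _ = Multiset.card M.charpoly.roots := Multiset.toFinset_sum_count_eq _
      _ ≤ M.charpoly.natDegree := card_roots' _
      _ = Module.finrank ℝ V := by rw [Matrix.charpoly_natDegree_eq_dim, Fintype.card_fin]
  rw [← Finset.add_sum_erase S _ hμS] at hsum
  have h2 : (S.erase μ).card * 2 ≤ ∑ z ∈ S.erase μ, M.charpoly.rootMultiplicity z := by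
    rw [← smul_eq_mul]
    exact Finset.card_nsmul_le_sum _ _ _ fun z hz => hcount z (Finset.mem_of_mem_erase hz)
  rw [Finset.card_erase_of_mem hμS] at h2
  obtain ⟨k, hk⟩ := heven μ hμ
  omega

end Hankel

/-! ### The second evolute as a product of two matrices -/

section MatrixModel

variable {n m : ℕ} {R : Type*} [CommRing R]

/-- The matrix of the mixed area form `∑ i, (a i * b (i + 1) - a (i + 1) * b i)`. -/
def cyclicSkew (n : ℕ) (R : Type*) [CommRing R] : Matrix (ZMod n) (ZMod n) R :=
  Matrix.of fun i k => (if k = i + 1 then 1 else 0) - (if i = k + 1 then 1 else 0)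

/-- The matrix whose row `i` carries the row `c` of `W i` in the columns `i, …, i + m - 1`. -/
def windowCoordinate (W : ZMod n → Matrix (Fin m) (Fin m) R) (c : Fin m) :
    Matrix (ZMod n) (ZMod n) R :=
  Matrix.of fun i k => ∑ r : Fin m, if i + ((r : ℕ) : ZMod n) = k then W i c r else 0

/-- Pull-back of the mixed area form along `U`. -/
def areaMatrix [NeZero n] (U : Matrix (ZMod n) (ZMod n) R) : Matrix (ZMod n) (ZMod n) R :=
  U.transpose * cyclicSkew n R * U

/-- Twice the matrix that sends the side lengths of a polygon on the line, with sides along the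
`x i`, to the products of `x j` with the midpoint of side `j`; the vertex `0` is at the origin. -/
def midpointMatrix (x : ZMod n → R) : Matrix (ZMod n) (ZMod n) R :=
  Matrix.of fun j i => x j * x i * (if i.val < j.val then 2 else if i = j then 1 else 0)

/-- The product of the total area form and the total midpoint matrix. Up to the factor `1 / 4` it
is the second evolute map, written in terms of side lengths. -/
def evoluteMatrix [NeZero n] (U : Fin m → Matrix (ZMod n) (ZMod n) R) (x : Fin m → ZMod n → R) :
    Matrix (ZMod n) (ZMod n) R :=
  (∑ c, areaMatrix (U c)) * ∑ c, midpointMatrix (x c)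

theorem dotProduct_areaMatrix_mulVec [NeZero n] (U : Matrix (ZMod n) (ZMod n) R)
    (a b : ZMod n → R) : a ⬝ᵥ (areaMatrix U).mulVec b =
      ∑ i, ((U.mulVec a) i * (U.mulVec b) (i + 1) - (U.mulVec a) (i + 1) * (U.mulVec b) i) := by
  have h : a ⬝ᵥ (areaMatrix U).mulVec b =
      U.mulVec a ⬝ᵥ (cyclicSkew n R).mulVec (U.mulVec b) := by
    rw [areaMatrix, ← Matrix.mulVec_mulVec, ← Matrix.mulVec_mulVec, Matrix.dotProduct_mulVec a,
      Matrix.vecMul_transpose]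
  have h1 : ∀ f g : ZMod n → R, f ⬝ᵥ (cyclicSkew n R).mulVec g =
      ∑ i, f i * g (i + 1) - ∑ i, f (i + 1) * g i := by
    intro f g
    simp only [cyclicSkew, Matrix.mulVec, dotProduct, Matrix.of_apply, sub_mul, ite_mul, one_mul,
      zero_mul, Finset.sum_sub_distrib, mul_sub, Finset.sum_ite_eq',
      Finset.mem_univ, if_true]
    congr 1
    simp only [Finset.mul_sum, mul_ite, mul_zero]
    rw [Finset.sum_comm]
    simp
  rw [h, h1, Finset.sum_sub_distrib]

/-- Heights coming from a common point of all hyperplanes give a constant polygon. -/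
theorem supportClass_inner [NeZero m] {v : ZMod n → Vec m} (hv : IsGeneric v) (q : Vec m) :
    supportClass hv (fun j => inner ℝ (v j) q) = 0 := by
  have hq : hyperplaneVertices v (fun j => inner ℝ (v j) q) = fun _ => q := by
    funext i
    refine sub_eq_zero.mp (eq_zero_of_inner hv i fun r => ?_)
    rw [inner_sub_right, inner_hyperplaneVertices hv, sub_self]
  have hmem : hyperplaneVertices v (fun j => inner ℝ (v j) q) ∈ translations n m :=
    ⟨q, by rw [hq]; rfl⟩
  rw [supportClass_apply, Submodule.Quotient.mk_eq_zero]
  exact hmem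

variable [NeZero n] {v : ZMod n → Vec m}

/-- The matrices computing the coordinates of the vertices from the heights of the hyperplanes. -/
noncomputable def vertexCoordinate (v : ZMod n → Vec m) (c : Fin m) :
    Matrix (ZMod n) (ZMod n) ℝ :=
  windowCoordinate (fun i => (rowMatrix v i)⁻¹) c

theorem hyperplaneVertices_apply (v : ZMod n → Vec m) (h : ZMod n → ℝ) (i : ZMod n) (c : Fin m) :
    hyperplaneVertices v h i c = (vertexCoordinate v c).mulVec h i := by
  simp only [hyperplaneVertices, LinearMap.coe_mk, AddHom.coe_mk, vertexCoordinate,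
    windowCoordinate, Matrix.mulVec, dotProduct, Matrix.of_apply, Finset.sum_mul, ite_mul,
    zero_mul]
  rw [Finset.sum_comm]
  simp

variable [NeZero m]

theorem sideLengths_evoluteOfDual_supportClass (hv : IsGeneric v) (h : ZMod n → ℝ) :
    sideLengths hv (evoluteOfDual v hv (supportClass hv h)) =
      (1 / 2 : ℝ) • (∑ c, areaMatrix (vertexCoordinate v c)).mulVec h := by
  funext j
  rw [sideLengths, LinearMap.pi_apply, supportClass_apply, supportClass_apply,
    polygonPairing_evoluteOfDual_mk, Pi.smul_apply, smul_eq_mul]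
  congr 1
  have h1 : ∀ w : ZMod n → ℝ, w j = Pi.single j 1 ⬝ᵥ w := fun w => by simp
  rw [h1 (Matrix.mulVec _ h), Matrix.sum_mulVec, dotProduct_sum]
  simp only [dotProduct_areaMatrix_mulVec, ← hyperplaneVertices_apply]
  rw [Finset.sum_comm]
  refine Finset.sum_congr rfl fun i _ => ?_
  simp only [PiLp.inner_apply, Finset.sum_sub_distrib, RCLike.inner_apply, conj_trivial, mul_comm]

/-- Telescoping over the indices that precede `j` in the order `0, 1, …, n - 1`. -/
theorem sub_apply_zero_eq_sum {M : Type*} [AddCommGroup M] (f : ZMod n → M) (j : ZMod n) :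
    f j - f 0 = ∑ i : ZMod n, if i.val < j.val then f (i + 1) - f i else 0 := by
  have key : ∀ k : ℕ, k < n →
      f (k : ZMod n) - f 0 = ∑ i : ZMod n, if i.val < k then f (i + 1) - f i else 0 := by
    intro k
    induction k with
    | zero => intro _; simp
    | succ k ih =>
      intro hk
      have hk' : k < n := by omega
      have hval : (k : ZMod n).val = k := ZMod.val_cast_of_lt hk'
      have hsplit : ∀ i : ZMod n, (if i.val < k + 1 then f (i + 1) - f i else 0) =
          (if i.val < k then f (i + 1) - f i else 0) +
            (if i = (k : ZMod n) then f (i + 1) - f i else 0) := by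
        intro i
        by_cases hi : i = (k : ZMod n)
        · rw [if_pos hi, hi, hval]
          simp
        · have : i.val ≠ k := fun h => hi (ZMod.val_injective n (by rw [hval, h]))
          rw [if_neg hi, add_zero]
          by_cases h2 : i.val < k
          · rw [if_pos h2, if_pos (by omega)]
          · rw [if_neg h2, if_neg (by omega)]
      rw [Finset.sum_congr rfl fun i _ => hsplit i, Finset.sum_add_distrib, ← ih hk',
        Finset.sum_ite_eq' Finset.univ (k : ZMod n), if_pos (Finset.mem_univ _)]
      push_cast
      abel
  have h := key j.val (ZMod.val_lt j)
  rwa [ZMod.natCast_zmod_val] at h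

/-- The midpoint matrix computes the heights of the perpendicular bisectors from the side lengths,
for the representative of the polygon with vertex `0` at the origin. -/
theorem supportClass_midpointMatrix (hv : IsGeneric v) (x : PolygonSpace v) :
    supportClass hv ((1 / 2 : ℝ) •
      (∑ c, midpointMatrix fun j => v j c).mulVec (sideLengths hv x)) = evolute v hv x := by
  obtain ⟨P, rfl⟩ := Submodule.Quotient.mk_surjective _ x
  set l := sideLengths hv (Submodule.Quotient.mk P) with hl
  have hP : ∀ j, (P : ZMod n → Vec m) (j + 1) - (P : ZMod n → Vec m) j = l j • v j :=
    fun j => sideLengths_mk hv P j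
  have hB : (1 / 2 : ℝ) • (∑ c, midpointMatrix fun j => v j c).mulVec l =
      (fun j => inner ℝ (v j) (midpoint ℝ ((P : ZMod n → Vec m) j) ((P : ZMod n → Vec m) (j + 1))))
        - fun j => inner ℝ (v j) ((P : ZMod n → Vec m) 0) := by
    funext j
    have h1 : midpoint ℝ ((P : ZMod n → Vec m) j) ((P : ZMod n → Vec m) (j + 1)) -
        (P : ZMod n → Vec m) 0 =
        ∑ i : ZMod n, ((1 / 2 : ℝ) * (if i.val < j.val then 2 else if i = j then 1 else 0) * l i) •
          v i := by
      have h2 := sub_apply_zero_eq_sum (P : ZMod n → Vec m) j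
      have h3 : midpoint ℝ ((P : ZMod n → Vec m) j) ((P : ZMod n → Vec m) (j + 1)) =
          (P : ZMod n → Vec m) j + (1 / 2 : ℝ) • (l j • v j) := by
        rw [← hP, midpoint_eq_smul_add, invOf_eq_inv]
        module
      have h4 : (1 / 2 : ℝ) • (l j • v j) =
          ∑ i : ZMod n, if i = j then (1 / 2 : ℝ) • (l i • v i) else 0 := by simp
      rw [h3, add_sub_right_comm, h2, h4, ← Finset.sum_add_distrib]
      refine Finset.sum_congr rfl fun i _ => ?_
      rw [hP]
      by_cases hij : i = j
      · simp [hij, smul_smul]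
      · by_cases hlt : i.val < j.val <;> simp [hij, hlt]
    rw [Pi.sub_apply, ← inner_sub_right, h1, inner_sum]
    simp only [Pi.smul_apply, smul_eq_mul, Matrix.sum_mulVec, Finset.sum_apply, Matrix.mulVec,
      dotProduct, midpointMatrix, Matrix.of_apply]
    rw [Finset.sum_comm, Finset.mul_sum]
    refine Finset.sum_congr rfl fun i _ => ?_
    rw [real_inner_smul_right, PiLp.inner_apply]
    simp only [RCLike.inner_apply, conj_trivial, Finset.mul_sum]
    refine Finset.sum_congr rfl fun c _ => ?_
    ring
  rw [hB, map_sub, supportClass_inner, sub_zero, evolute_mk, supportClass_apply]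
  congr 2
  exact (evoluteVertices_zero v P).symm

theorem trace_comp_pow_comm {V W : Type*} [AddCommGroup V] [Module ℝ V] [FiniteDimensional ℝ V]
    [AddCommGroup W] [Module ℝ W] [FiniteDimensional ℝ W] (f : V →ₗ[ℝ] W) (g : W →ₗ[ℝ] V)
    (k : ℕ) : LinearMap.trace ℝ V ((g ∘ₗ f : Module.End ℝ V) ^ (k + 1)) =
      LinearMap.trace ℝ W ((f ∘ₗ g : Module.End ℝ W) ^ (k + 1)) := by
  have h : ∀ k, (g ∘ₗ f : Module.End ℝ V) ^ (k + 1) =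
      g ∘ₗ (((f ∘ₗ g : Module.End ℝ W) ^ k : Module.End ℝ W) ∘ₗ f) := by
    intro k
    induction k with
    | zero => ext; simp
    | succ k ih => rw [pow_succ', ih, pow_succ']; rfl
  rw [h, LinearMap.trace_comp_comm', pow_succ, Module.End.mul_eq_comp, LinearMap.comp_assoc]

/-- The matrix of the second evolute map in terms of side lengths, up to the factor `1 / 4`. -/
noncomputable def evoluteMatrixOf (v : ZMod n → Vec m) : Matrix (ZMod n) (ZMod n) ℝ :=
  evoluteMatrix (vertexCoordinate v) fun c j => v j c

/-- The second evolute map and the matrix factor through each other as `g ∘ f` and `f ∘ g`, where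
`f` assigns to a polygon its side lengths, so their powers have the same traces. -/
theorem trace_secondEvolute_pow (hv : IsGeneric v) (k : ℕ) :
    LinearMap.trace ℝ _ (secondEvolute v hv ^ (k + 1)) =
      (((1 / 4 : ℝ) • evoluteMatrixOf v) ^ (k + 1)).trace := by
  let g : (ZMod n → ℝ) →ₗ[ℝ] PolygonSpace v := evoluteOfDual v hv ∘ₗ supportClass hv ∘ₗ
    ((1 / 2 : ℝ) • (∑ c, midpointMatrix fun j => v j c)).mulVecLin
  have h1 : g ∘ₗ sideLengths hv = secondEvolute v hv := by
    refine LinearMap.ext fun x => ?_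
    simp only [g, LinearMap.comp_apply, Matrix.mulVecLin_apply, Matrix.smul_mulVec,
      supportClass_midpointMatrix]
    rfl
  have h2 : sideLengths hv ∘ₗ g = Matrix.toLin' ((1 / 4 : ℝ) • evoluteMatrixOf v) := by
    refine LinearMap.ext fun h => ?_
    simp only [g, LinearMap.comp_apply, Matrix.mulVecLin_apply, Matrix.smul_mulVec,
      sideLengths_evoluteOfDual_supportClass, Matrix.toLin'_apply, evoluteMatrixOf, evoluteMatrix,
      Matrix.mulVec_smul, Matrix.mulVec_mulVec, smul_smul]
    norm_num
  rw [← h1, trace_comp_pow_comm, h2, ← Matrix.toLin'_pow, Matrix.trace_toLin'_eq]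

theorem det_hankelTrace_smul {ι : Type*} [Fintype ι] [DecidableEq ι] (a : R) (M : Matrix ι ι R)
    (r : ℕ) : (hankelTrace (a • M) r).det =
      (∏ i : Fin r, a ^ (i : ℕ)) * ((∏ i : Fin r, a ^ ((i : ℕ) + 1)) * (hankelTrace M r).det) := by
  rw [← Matrix.det_mul_row, ← Matrix.det_mul_column]
  congr 1
  ext i j
  simp only [hankelTrace, Matrix.of_apply, smul_pow, Matrix.trace_smul, smul_eq_mul]
  ring

theorem det_hankelTrace_smul_ne_zero {ι : Type*} [Fintype ι] [DecidableEq ι] [IsDomain R] {a : R}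
    (ha : a ≠ 0) (M : Matrix ι ι R) (r : ℕ) :
    (hankelTrace (a • M) r).det ≠ 0 ↔ (hankelTrace M r).det ≠ 0 := by
  have h1 : (∏ i : Fin r, a ^ (i : ℕ)) ≠ 0 :=
    Finset.prod_ne_zero_iff.mpr fun i _ => pow_ne_zero _ ha
  have h2 : (∏ i : Fin r, a ^ ((i : ℕ) + 1)) ≠ 0 :=
    Finset.prod_ne_zero_iff.mpr fun i _ => pow_ne_zero _ ha
  rw [det_hankelTrace_smul]
  simp [h1, h2]

theorem eigenvalueMultiplicity_eq_two (hv : IsGeneric v)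
    (h : (hankelTrace (evoluteMatrixOf v) ((n - m) / 2)).det ≠ 0) {μ : ℂ} (hμ : μ ≠ 0)
    (hμ0 : eigenvalueMultiplicity v hv μ ≠ 0) : eigenvalueMultiplicity v hv μ = 2 := by
  refine rootMultiplicity_eq_two (secondEvolute v hv) (finrank_polygonSpace_le hv)
    (fun μ hμ => even_eigenvalueMultiplicity hv hμ) ?_ hμ hμ0
  simp only [trace_secondEvolute_pow]
  exact (det_hankelTrace_smul_ne_zero (by norm_num) _ _).mpr h

end MatrixModel

/-! ### The nondegeneracy polynomial -/

section Polynomiality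

open Filter Topology

variable {n m : ℕ}

section Ring

variable {R S : Type*} [CommRing R] [CommRing S]

/-- The matrix with rows `v i, …, v (i + m - 1)`, over any ring. -/
def windowMatrix (v : ZMod n → Fin m → R) (i : ZMod n) : Matrix (Fin m) (Fin m) R :=
  Matrix.of fun r c => v (i + ((r : ℕ) : ZMod n)) c

theorem windowMatrix_map (f : R →+* S) (v : ZMod n → Fin m → R) (i : ZMod n) :
    windowMatrix (fun j c => f (v j c)) i = f.mapMatrix (windowMatrix v i) := rfl

theorem windowCoordinate_smul (a : R) (W : ZMod n → Matrix (Fin m) (Fin m) R) (c : Fin m) :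
    windowCoordinate (fun i => a • W i) c = a • windowCoordinate W c := by
  ext i k
  simp only [windowCoordinate, Matrix.of_apply, Matrix.smul_apply, smul_eq_mul, Finset.mul_sum,
    mul_ite, mul_zero]

variable [NeZero n]

theorem windowCoordinate_map (f : R →+* S) (W : ZMod n → Matrix (Fin m) (Fin m) R) (c : Fin m) :
    windowCoordinate (fun i => f.mapMatrix (W i)) c = f.mapMatrix (windowCoordinate W c) := by
  ext i k
  simp only [windowCoordinate, Matrix.of_apply, RingHom.mapMatrix_apply, Matrix.map_apply, map_sum]
  refine Finset.sum_congr rfl fun r _ => ?_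
  split_ifs <;> simp

/-- The product of the determinants of all windows; over a field it vanishes exactly at the
sequences that are not generic. -/
def windowDetProd (v : ZMod n → Fin m → R) : R :=
  ∏ i, (windowMatrix v i).det

/-- The inverse of the window matrix, multiplied by `windowDetProd v` to clear denominators. -/
def clearedInverse (v : ZMod n → Fin m → R) (i : ZMod n) : Matrix (Fin m) (Fin m) R :=
  (∏ k ∈ Finset.univ.erase i, (windowMatrix v k).det) • (windowMatrix v i).adjugate

/-- A polynomial in the coordinates of the `v i`. It does not vanish exactly when `v` is generic
and the Hankel determinant of size `r` of the second evolute map does not vanish. -/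
def nondegeneracyPoly (v : ZMod n → Fin m → R) (r : ℕ) : R :=
  windowDetProd v *
    (hankelTrace (evoluteMatrix (windowCoordinate (clearedInverse v)) fun c j => v j c) r).det

variable (f : R →+* S)

theorem windowDetProd_map (v : ZMod n → Fin m → R) :
    windowDetProd (fun j c => f (v j c)) = f (windowDetProd v) := by
  simp only [windowDetProd, windowMatrix_map, map_prod, RingHom.map_det]

theorem clearedInverse_map (v : ZMod n → Fin m → R) (i : ZMod n) :
    clearedInverse (fun j c => f (v j c)) i = f.mapMatrix (clearedInverse v i) := by
  simp only [clearedInverse, windowMatrix_map, ← RingHom.map_det, ← map_prod,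
    ← RingHom.map_adjugate]
  ext r c
  simp

theorem areaMatrix_map (U : Matrix (ZMod n) (ZMod n) R) :
    areaMatrix (f.mapMatrix U) = f.mapMatrix (areaMatrix U) := by
  have h : cyclicSkew n S = f.mapMatrix (cyclicSkew n R) := by
    ext i k
    simp only [cyclicSkew, Matrix.of_apply, RingHom.mapMatrix_apply, Matrix.map_apply]
    split_ifs <;> simp
  rw [areaMatrix, areaMatrix, h, map_mul, map_mul]
  rfl

theorem midpointMatrix_map (x : ZMod n → R) :
    midpointMatrix (fun j => f (x j)) = f.mapMatrix (midpointMatrix x) := by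
  ext i k
  simp only [midpointMatrix, Matrix.of_apply, RingHom.mapMatrix_apply, Matrix.map_apply, map_mul]
  rw [apply_ite f, apply_ite f, map_ofNat, map_one, map_zero]

theorem nondegeneracyPoly_map (v : ZMod n → Fin m → R) (r : ℕ) :
    nondegeneracyPoly (fun j c => f (v j c)) r = f (nondegeneracyPoly v r) := by
  have h1 : windowCoordinate (clearedInverse fun j c => f (v j c)) =
      fun c => f.mapMatrix (windowCoordinate (clearedInverse v) c) := by
    funext c
    rw [← windowCoordinate_map]
    congr 1
    funext i
    exact clearedInverse_map f v i
  simp only [nondegeneracyPoly, windowDetProd_map, h1, evoluteMatrix, areaMatrix_map,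
    midpointMatrix_map, ← map_sum, ← map_mul, det_hankelTrace_map]

theorem areaMatrix_smul (a : R) (U : Matrix (ZMod n) (ZMod n) R) :
    areaMatrix (a • U) = (a * a) • areaMatrix U := by
  rw [areaMatrix, areaMatrix, Matrix.transpose_smul, Matrix.smul_mul, Matrix.smul_mul,
    Matrix.mul_smul, smul_smul]

end Ring

theorem windowMatrix_coe (v : ZMod n → Vec m) (i : ZMod n) :
    windowMatrix (fun j c => v j c) i = rowMatrix v i := rfl

theorem rowMatrix_rescale (v : ZMod n → Vec m) (a : ZMod n → ℝ) (i : ZMod n) :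
    rowMatrix (fun j => a j • v j) i =
      Matrix.diagonal (fun r : Fin m => a (i + ((r : ℕ) : ZMod n))) * rowMatrix v i := by
  ext r c
  rw [Matrix.diagonal_mul]
  rfl

theorem isGeneric_rescale {v : ZMod n → Vec m} {a : ZMod n → ℝ} (ha : ∀ j, a j ≠ 0)
    (hv : IsGeneric v) : IsGeneric fun j => a j • v j := by
  refine isGeneric_of_det fun i => ?_
  rw [rowMatrix_rescale, Matrix.det_mul, Matrix.det_diagonal]
  exact mul_ne_zero (Finset.prod_ne_zero_iff.mpr fun r _ => ha _) (det_rowMatrix_ne_zero hv i)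

theorem eventually_eval_ne_zero {p : Polynomial ℝ} (hp : p ≠ 0) (a : ℝ) :
    ∀ᶠ t in 𝓝[≠] a, p.eval t ≠ 0 := by
  have hfin : ({t | p.IsRoot t} \ {a}).Finite := (Polynomial.finite_setOfPred_isRoot hp).subset
    Set.sdiff_subset
  have h1 : ({t | p.IsRoot t} \ {a})ᶜ ∈ 𝓝 a := hfin.isClosed.compl_mem_nhds (by simp)
  filter_upwards [nhdsWithin_le_nhds h1, self_mem_nhdsWithin] with t ht hta h0
  exact ht ⟨h0, hta⟩

/-- A function given by polynomials over every ring, so that it commutes with ring homomorphisms,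
has only finitely many zeros on a line on which it does not vanish identically. -/
theorem eventually_line_ne_zero {F : ∀ {R : Type} [CommRing R], (ZMod n → Fin m → R) → R}
    (hF : ∀ {R S : Type} [CommRing R] [CommRing S] (f : R →+* S) (v : ZMod n → Fin m → R),
      F (fun j c => f (v j c)) = f (F v)) (v w : ZMod n → Fin m → ℝ) (hw : F w ≠ 0) :
    ∀ᶠ t in 𝓝[≠] (0 : ℝ), F (fun j c => v j c + t * (w j c - v j c)) ≠ 0 := by
  let p : Polynomial ℝ := F fun j c =>
    Polynomial.C (v j c) + Polynomial.X * Polynomial.C (w j c - v j c)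
  have hp : ∀ t, p.eval t = F fun j c => v j c + t * (w j c - v j c) := by
    intro t
    have := hF (Polynomial.evalRingHom t)
      fun j c => Polynomial.C (v j c) + Polynomial.X * Polynomial.C (w j c - v j c)
    simp only [map_add, map_mul, Polynomial.coe_evalRingHom, Polynomial.eval_C,
      Polynomial.eval_X] at this
    exact this.symm
  have hp0 : p ≠ 0 := by
    intro h
    have h1 := hp 1
    rw [h] at h1
    simp at h1
    exact hw h1.symm
  filter_upwards [eventually_eval_ne_zero hp0 0] with t ht
  rwa [← hp]

variable [NeZero n]

theorem windowDetProd_ne_zero_iff (v : ZMod n → Vec m) :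
    windowDetProd (fun j c => v j c) ≠ 0 ↔ IsGeneric v := by
  simp only [windowDetProd, windowMatrix_coe, Finset.prod_ne_zero_iff, Finset.mem_univ,
    forall_const]
  exact ⟨isGeneric_of_det, det_rowMatrix_ne_zero⟩

theorem clearedInverse_eq {v : ZMod n → Vec m} (hv : IsGeneric v) (i : ZMod n) :
    clearedInverse (fun j c => v j c) i =
      windowDetProd (fun j c => v j c) • (rowMatrix v i)⁻¹ := by
  have hd := det_rowMatrix_ne_zero hv i
  rw [clearedInverse, windowDetProd, Matrix.inv_def, Ring.inverse_eq_inv', smul_smul,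
    ← Finset.mul_prod_erase _ _ (Finset.mem_univ i)]
  simp only [windowMatrix_coe]
  congr 1
  field_simp

theorem nondegeneracyPoly_ne_zero_iff [NeZero m] (v : ZMod n → Vec m) (r : ℕ) :
    nondegeneracyPoly (fun j c => v j c) r ≠ 0 ↔
      IsGeneric v ∧ (hankelTrace (evoluteMatrixOf v) r).det ≠ 0 := by
  rw [nondegeneracyPoly, mul_ne_zero_iff, windowDetProd_ne_zero_iff]
  refine and_congr_right fun hv => ?_
  set a := windowDetProd fun j c => v j c with ha
  have ha0 : a ≠ 0 := (windowDetProd_ne_zero_iff v).mpr hv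
  have h1 : windowCoordinate (clearedInverse fun j c => v j c) =
      fun c => a • vertexCoordinate v c := by
    funext c
    rw [vertexCoordinate, ← windowCoordinate_smul]
    congr 1
    funext i
    exact clearedInverse_eq hv i
  have h2 : evoluteMatrix (windowCoordinate (clearedInverse fun j c => v j c))
      (fun c j => v j c) = (a * a) • evoluteMatrixOf v := by
    simp only [h1, evoluteMatrixOf, evoluteMatrix, areaMatrix_smul, ← Finset.smul_sum,
      Matrix.smul_mul]
  rw [h2]
  exact det_hankelTrace_smul_ne_zero (mul_ne_zero ha0 ha0) _ _

/-! ### Rescaling the directions -/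

theorem vertexCoordinate_rescale (v : ZMod n → Vec m) {a : ZMod n → ℝ} (ha : ∀ j, a j ≠ 0)
    (c : Fin m) : vertexCoordinate (fun j => a j • v j) c =
      vertexCoordinate v c * Matrix.diagonal fun j => (a j)⁻¹ := by
  have hinv : ∀ i : ZMod n, (Matrix.diagonal fun r : Fin m => a (i + ((r : ℕ) : ZMod n)))⁻¹ =
      Matrix.diagonal fun r : Fin m => (a (i + ((r : ℕ) : ZMod n)))⁻¹ := by
    intro i
    refine Matrix.inv_eq_right_inv ?_
    rw [Matrix.diagonal_mul_diagonal, ← Matrix.diagonal_one]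
    congr 1
    funext r
    exact mul_inv_cancel₀ (ha _)
  ext i k
  rw [Matrix.mul_diagonal]
  simp only [vertexCoordinate, windowCoordinate, Matrix.of_apply, rowMatrix_rescale,
    Matrix.mul_inv_rev, hinv, Matrix.mul_diagonal, Finset.sum_mul, ite_mul, zero_mul]
  refine Finset.sum_congr rfl fun r _ => ?_
  split_ifs with h
  · rw [h]
  · rfl

theorem hankelTrace_conj {ι : Type*} [Fintype ι] [DecidableEq ι] (M D E : Matrix ι ι ℝ)
    (h : D * E = 1) (r : ℕ) : hankelTrace (E * M * D) r = hankelTrace M r := by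
  have hpow : ∀ k, (E * M * D) ^ (k + 1) = E * M ^ (k + 1) * D := by
    intro k
    induction k with
    | zero => simp
    | succ k ih =>
      rw [pow_succ, ih, pow_succ M (k + 1)]
      calc E * M ^ (k + 1) * D * (E * M * D) = E * M ^ (k + 1) * (D * E) * M * D := by
            simp only [Matrix.mul_assoc]
        _ = _ := by rw [h, Matrix.mul_one]; simp only [Matrix.mul_assoc]
  ext i j
  rw [hankelTrace, hankelTrace, Matrix.of_apply, Matrix.of_apply, hpow, Matrix.trace_mul_comm,
    ← Matrix.mul_assoc, h, Matrix.one_mul]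

theorem hankelTrace_evoluteMatrixOf_rescale [NeZero m] (v : ZMod n → Vec m) {a : ZMod n → ℝ}
    (ha : ∀ j, a j ≠ 0) (r : ℕ) :
    hankelTrace (evoluteMatrixOf fun j => a j • v j) r = hankelTrace (evoluteMatrixOf v) r := by
  set D := Matrix.diagonal a with hD
  set E := Matrix.diagonal (fun j => (a j)⁻¹) with hE
  have hDE : E * D = 1 := by
    rw [hD, hE, Matrix.diagonal_mul_diagonal, ← Matrix.diagonal_one]
    congr 1
    funext r
    exact inv_mul_cancel₀ (ha _)
  have hDE' : D * E = 1 := mul_eq_one_comm.mp hDE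
  have hJ : ∀ c, areaMatrix (vertexCoordinate (fun j => a j • v j) c) =
      E * areaMatrix (vertexCoordinate v c) * E := by
    intro c
    rw [vertexCoordinate_rescale v ha, areaMatrix, areaMatrix, Matrix.transpose_mul, ← hE, hE,
      Matrix.diagonal_transpose]
    simp only [Matrix.mul_assoc]
  have hB : ∀ c, midpointMatrix (fun j => (a j • v j) c) =
      D * midpointMatrix (fun j => v j c) * D := by
    intro c
    ext i j
    rw [Matrix.mul_diagonal, Matrix.diagonal_mul]
    simp only [midpointMatrix, Matrix.of_apply, PiLp.smul_apply, smul_eq_mul]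
    ring
  have h : evoluteMatrixOf (fun j => a j • v j) = E * evoluteMatrixOf v * D := by
    simp only [evoluteMatrixOf, evoluteMatrix, hJ, hB, ← Finset.mul_sum, ← Finset.sum_mul]
    calc _ = E * (∑ c, areaMatrix (vertexCoordinate v c)) * (E * D) *
          (∑ c, midpointMatrix fun j => v j c) * D := by simp only [Matrix.mul_assoc]
      _ = _ := by rw [hDE, Matrix.mul_one]; simp only [Matrix.mul_assoc]
  rw [h, hankelTrace_conj _ _ _ hDE']

/-! ### Openness and density -/

theorem continuous_nondegeneracyPoly (r : ℕ) :
    Continuous fun v : ZMod n → Fin m → ℝ => nondegeneracyPoly v r := by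
  let p : MvPolynomial (ZMod n × Fin m) ℝ :=
    nondegeneracyPoly (fun j c => MvPolynomial.X (j, c)) r
  have hp : ∀ v : ZMod n → Fin m → ℝ,
      nondegeneracyPoly v r = MvPolynomial.eval (fun jc : ZMod n × Fin m => v jc.1 jc.2) p := by
    intro v
    rw [← nondegeneracyPoly_map]
    simp
  simp only [hp]
  exact (MvPolynomial.continuous_eval p).comp (by fun_prop)

/-- The spherical polygons at which the nondegeneracy polynomial does not vanish. -/
def nondegeneratePolygons (n m r : ℕ) [NeZero n] : Set (SphericalPolygon n m) :=
  {v | nondegeneracyPoly (fun j c => v.vec j c) r ≠ 0}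

theorem isOpen_nondegeneratePolygons (r : ℕ) : IsOpen (nondegeneratePolygons n m r) := by
  refine isOpen_ne_fun ((continuous_nondegeneracyPoly r).comp ?_) continuous_const
  simp only [SphericalPolygon.vec]
  fun_prop

/-- If the nondegeneracy polynomial does not vanish at `w`, then it has only finitely many zeros on
the line from `v` to `w`; the points of this line near `v` are projected to the sphere. -/
theorem dense_nondegeneratePolygons [NeZero m] {r : ℕ} {w : ZMod n → Vec m}
    (hw : nondegeneracyPoly (fun j c => w j c) r ≠ 0) :
    Dense (nondegeneratePolygons n m r) := by
  intro v
  let x : ℝ → ZMod n → Vec m := fun t j => (v j : Vec m) + t • (w j - v j)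
  have hx : ∀ j, Tendsto (fun t => x t j) (𝓝[≠] 0) (𝓝 (v j : Vec m)) := by
    intro j
    have h : Continuous fun t => x t j := by fun_prop
    have h1 := h.tendsto 0
    simp only [x, zero_smul, add_zero] at h1
    exact h1.mono_left nhdsWithin_le_nhds
  have hv0 : ∀ j, (v j : Vec m) ≠ 0 := fun j => ne_zero_of_mem_unit_sphere (v j)
  have hne : ∀ᶠ t in 𝓝[≠] (0 : ℝ), ∀ j, x t j ≠ 0 :=
    eventually_all.mpr fun j => (hx j).eventually_ne (hv0 j)
  let y : ℝ → SphericalPolygon n m := fun t j =>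
    if h : x t j ≠ 0 then ⟨‖x t j‖⁻¹ • x t j, by
      rw [mem_sphere_zero_iff_norm, norm_smul, norm_inv, norm_norm,
        inv_mul_cancel₀ (norm_ne_zero_iff.mpr h)]⟩ else v j
  have hy : ∀ᶠ t in 𝓝[≠] (0 : ℝ), (y t).vec = fun j => ‖x t j‖⁻¹ • x t j := by
    filter_upwards [hne] with t ht
    funext j
    simp only [SphericalPolygon.vec, y, dif_pos (ht j)]
  have hlim : Tendsto y (𝓝[≠] 0) (𝓝 v) := by
    refine tendsto_pi_nhds.mpr fun j => tendsto_subtype_rng.mpr ?_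
    have h1 : Tendsto (fun t => ‖x t j‖⁻¹ • x t j) (𝓝[≠] 0) (𝓝 (v j : Vec m)) := by
      have h2 := ((hx j).norm.inv₀ (norm_ne_zero_iff.mpr (hv0 j))).smul (hx j)
      rwa [norm_eq_of_mem_sphere (v j), inv_one, one_smul] at h2
    refine h1.congr' ?_
    filter_upwards [hy] with t ht
    exact (congrFun ht j).symm
  refine mem_closure_of_tendsto hlim ?_
  have hF := eventually_line_ne_zero (F := fun {R} _ v => nondegeneracyPoly v r)
    (fun f v => nondegeneracyPoly_map f v r) (fun j c => (v j : Vec m) c) (fun j c => w j c) hw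
  filter_upwards [hy, hne, hF] with t hyt hnet hFt
  have h1 : nondegeneracyPoly (fun j c => x t j c) r ≠ 0 := hFt
  rw [nondegeneracyPoly_ne_zero_iff] at h1
  have ha : ∀ j, ‖x t j‖⁻¹ ≠ 0 := fun j => inv_ne_zero (norm_ne_zero_iff.mpr (hnet j))
  change nondegeneracyPoly (fun j c => (y t).vec j c) r ≠ 0
  rw [nondegeneracyPoly_ne_zero_iff, hyt]
  refine ⟨isGeneric_rescale ha h1.1, ?_⟩
  rw [hankelTrace_evoluteMatrixOf_rescale (x t) ha]
  exact h1.2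

end Polynomiality

/-! ### The area form of a path -/

section PathMatrix

theorem hankelTrace_mul_comm {R ι : Type*} [CommRing R] [Fintype ι] [DecidableEq ι]
    (A B : Matrix ι ι R) (r : ℕ) : hankelTrace (A * B) r = hankelTrace (B * A) r := by
  have hpow : ∀ k, (A * B) ^ (k + 1) = A * ((B * A) ^ k * B) := by
    intro k
    induction k with
    | zero => simp
    | succ k ih => rw [pow_succ', ih, pow_succ' (B * A)]; simp only [Matrix.mul_assoc]
  ext i j
  rw [hankelTrace, hankelTrace, Matrix.of_apply, Matrix.of_apply, hpow, Matrix.trace_mul_comm,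
    Matrix.mul_assoc, ← pow_succ]

/-- For a skew-symmetric matrix `Z` the Hankel form of `-Z ^ 2` is
`c ↦ ‖∑ i, c i • Z * (-Z ^ 2) ^ i‖ ^ 2` in the Frobenius norm. It is positive definite if the odd
powers of `Z` are linearly independent. -/
theorem det_hankelTrace_neg_sq_ne_zero {ι : Type*} [Fintype ι] [DecidableEq ι] {Z : Matrix ι ι ℝ}
    (hZ : Z.transpose = -Z) {r : ℕ}
    (hind : ∀ c : Fin r → ℝ, ∑ i, c i • Z ^ (2 * (i : ℕ) + 1) = 0 → c = 0) :
    (hankelTrace (-(Z * Z)) r).det ≠ 0 := by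
  intro hdet
  obtain ⟨c, hc0, hc⟩ := Matrix.exists_mulVec_eq_zero_iff.mpr hdet
  set A := -(Z * Z) with hA
  have hAZ : A = Z.transpose * Z := by rw [hZ, hA, Matrix.neg_mul]
  have hAt : ∀ k, (A ^ k).transpose = A ^ k := by
    intro k
    rw [Matrix.transpose_pow, hA, Matrix.transpose_neg, Matrix.transpose_mul, hZ]
    simp
  set p := ∑ i : Fin r, c i • A ^ (i : ℕ) with hp
  have hpt : p.transpose = p := by
    rw [hp, Matrix.transpose_sum]
    simp only [Matrix.transpose_smul, hAt]
  have htr : ((Z * p).transpose * (Z * p)).trace = 0 := by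
    have h1 : (Z * p).transpose * (Z * p) = p * A * p := by
      rw [Matrix.transpose_mul, hpt, hAZ]
      simp only [Matrix.mul_assoc]
    have h2 : (p * A * p).trace = c ⬝ᵥ (hankelTrace A r).mulVec c := by
      rw [hp]
      simp only [Finset.sum_mul, Finset.mul_sum, Matrix.trace_sum, dotProduct, Matrix.mulVec,
        hankelTrace, Matrix.of_apply]
      rw [Finset.sum_comm]
      refine Finset.sum_congr rfl fun i _ => Finset.sum_congr rfl fun j _ => ?_
      rw [Matrix.smul_mul, Matrix.smul_mul, Matrix.mul_smul, smul_smul, Matrix.trace_smul,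
        smul_eq_mul, ← pow_succ, ← pow_add]
      rw [show (i : ℕ) + 1 + j = i + j + 1 by ring]
      ring
    rw [h1, h2, hc, dotProduct_zero]
  have hZp : Z * p = 0 := by
    have := Matrix.trace_conjTranspose_mul_self_eq_zero_iff (A := Z * p)
    rw [Matrix.conjTranspose_eq_transpose_of_trivial] at this
    exact this.mp htr
  have hsum : ∑ i : Fin r, (c i * (-1) ^ (i : ℕ)) • Z ^ (2 * (i : ℕ) + 1) = 0 := by
    rw [← hZp, hp, Finset.mul_sum]
    refine Finset.sum_congr rfl fun i _ => ?_
    rw [Matrix.mul_smul, mul_smul]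
    congr 1
    rw [hA, ← sq]
    rcases Nat.even_or_odd (i : ℕ) with h | h
    · rw [h.neg_one_pow, one_smul, h.neg_pow, ← pow_mul, pow_succ']
    · rw [h.neg_one_pow, neg_smul, one_smul, h.neg_pow, Matrix.mul_neg, ← pow_mul, pow_succ']
  have h := hind _ hsum
  refine hc0 (funext fun i => ?_)
  have := congrFun h i
  simpa using this

variable {n : ℕ} (m : ℕ)

/-- The indices `1, …, n - m`. -/
def InRange (i : ZMod n) : Prop := 1 ≤ i.val ∧ i.val + m ≤ n

instance (i : ZMod n) : Decidable (InRange m i) := inferInstanceAs (Decidable (_ ∧ _))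

/-- The restriction of the cyclic area form to the path `1, …, n - m`. -/
def pathSkew (n m : ℕ) : Matrix (ZMod n) (ZMod n) ℝ :=
  Matrix.of fun i k => if InRange m i ∧ InRange m k then
    (if k.val = i.val + 1 then 1 else 0) - (if i.val = k.val + 1 then 1 else 0) else 0

theorem pathSkew_apply (i k : ZMod n) : pathSkew n m i k =
    if InRange m i ∧ InRange m k then
      (if k.val = i.val + 1 then 1 else 0) - (if i.val = k.val + 1 then 1 else 0) else 0 := rfl

theorem pathSkew_transpose : (pathSkew n m).transpose = -pathSkew n m := by
  ext i k
  rw [Matrix.transpose_apply, Matrix.neg_apply, pathSkew_apply, pathSkew_apply]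
  by_cases h : InRange m i ∧ InRange m k
  · rw [if_pos h, if_pos h.symm]; ring
  · rw [if_neg h, if_neg fun h' => h h'.symm, neg_zero]

variable {m}

theorem val_eq_iff [NeZero n] {p : ℕ} (hp : p < n) (k : ZMod n) :
    k.val = p ↔ k = (p : ZMod n) := by
  constructor
  · rintro rfl; exact (ZMod.natCast_zmod_val k).symm
  · rintro rfl; exact ZMod.val_cast_of_lt hp

/-- Starting at the end of the path, the `k`-th power reaches exactly `k` steps. -/
theorem pathSkew_pow_apply_one [NeZero n] (hn : 2 ≤ n) (k : ℕ) :
    (∀ j : ZMod n, k + 1 < j.val → (pathSkew n m ^ k) j 1 = 0) ∧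
      ∀ j : ZMod n, j.val = k + 1 → j.val + m ≤ n → (pathSkew n m ^ k) j 1 = (-1) ^ k := by
  have h1 : (1 : ZMod n).val = 1 := by
    have := ZMod.val_cast_of_lt (n := n) (a := 1) (by omega)
    simpa using this
  induction k with
  | zero =>
    refine ⟨fun j hj => ?_, fun j hj _ => ?_⟩
    · rw [pow_zero, Matrix.one_apply_ne]
      rintro rfl
      omega
    · rw [pow_zero, pow_zero, ZMod.val_injective n (hj.trans h1.symm), Matrix.one_apply_eq]
  | succ k ih =>
    refine ⟨fun j hj => ?_, fun j hj hjm => ?_⟩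
    · rw [pow_succ', Matrix.mul_apply]
      refine Finset.sum_eq_zero fun l _ => ?_
      by_cases hl : k + 1 < l.val
      · rw [ih.1 l hl, mul_zero]
      · rw [pathSkew_apply, if_neg (show ¬l.val = j.val + 1 by omega),
          if_neg (show ¬j.val = l.val + 1 by omega)]
        simp
    · have hk : k + 1 < n := by have := ZMod.val_lt j; omega
      have hval : ((k + 1 : ℕ) : ZMod n).val = k + 1 := ZMod.val_cast_of_lt hk
      rw [pow_succ', Matrix.mul_apply, Finset.sum_eq_single ((k + 1 : ℕ) : ZMod n)]
      · rw [ih.2 _ hval (by omega), pathSkew_apply, if_pos, if_neg, if_pos]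
        · ring
        · omega
        · omega
        · exact ⟨⟨by omega, hjm⟩, ⟨by omega, by omega⟩⟩
      · intro l _ hl
        by_cases hlt : k + 1 < l.val
        · rw [ih.1 l hlt, mul_zero]
        · have hne : l.val ≠ k + 1 := fun h => hl ((val_eq_iff hk l).mp h)
          rw [pathSkew_apply, if_neg (show ¬l.val = j.val + 1 by omega),
            if_neg (show ¬j.val = l.val + 1 by omega)]
          simp
      · simp

theorem det_hankelTrace_pathSkew_ne_zero [NeZero n] (hn : 2 ≤ n) {r : ℕ} (hr : 2 * r + m ≤ n)
    (hm : 1 ≤ m) : (hankelTrace (-(pathSkew n m * pathSkew n m)) r).det ≠ 0 := by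
  refine det_hankelTrace_neg_sq_ne_zero (pathSkew_transpose m) fun c hc => ?_
  by_contra hne
  have hS : (Finset.univ.filter fun i => c i ≠ 0).Nonempty := by
    obtain ⟨i, hi⟩ := Function.ne_iff.mp hne
    exact ⟨i, by simpa using hi⟩
  obtain ⟨i, hi, hmax⟩ := Finset.exists_max_image _ (fun i : Fin r => (i : ℕ)) hS
  have hi2 := i.2
  have hval : ((2 * (i : ℕ) + 2 : ℕ) : ZMod n).val = 2 * (i : ℕ) + 2 :=
    ZMod.val_cast_of_lt (by omega)
  have h := congrFun (congrFun hc ((2 * (i : ℕ) + 2 : ℕ) : ZMod n)) 1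
  rw [Matrix.sum_apply, Finset.sum_eq_single i] at h
  · rw [Matrix.smul_apply, (pathSkew_pow_apply_one hn _).2 _ hval (by omega)] at h
    have hci : c i ≠ 0 := by simpa using hi
    simp at h
    exact hci h
  · intro b _ hb
    by_cases hcb : c b = 0
    · rw [hcb, zero_smul]; rfl
    · have hle := hmax b (by simpa using hcb)
      have hne' : (b : ℕ) ≠ i := fun e => hb (Fin.ext e)
      rw [Matrix.smul_apply, (pathSkew_pow_apply_one hn _).1 _ (by rw [hval]; omega), smul_zero]
  · simp

/-! ### The limit matrices -/

/-- The vertex coordinates of the model family with parameter `e`, along the first coordinate. -/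
def modelCoordinate (n m : ℕ) (e : ℝ) : Matrix (ZMod n) (ZMod n) ℝ :=
  Matrix.of fun i k => if InRange m i then
    (if k.val = i.val then e else 0) + (if k.val = i.val + (m - 1) then 1 else 0) -
      (if k.val = i.val + (m - 2) then 1 else 0)
    else if k = 0 then 1 else 0

/-- The rows of `modelCoordinate n m 0` on the path are differences of consecutive unit vectors, so
they take the midpoint matrix to the negative of the area form of the path. -/
theorem modelCoordinate_mul_midpointMatrix_mul [NeZero n] (hm : 2 ≤ m) :
    modelCoordinate n m 0 *
      midpointMatrix (fun j : ZMod n => if m - 1 ≤ j.val then (1 : ℝ) else 0) *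
      (modelCoordinate n m 0).transpose = -pathSkew n m := by
  set B := midpointMatrix (fun j : ZMod n => if m - 1 ≤ j.val then (1 : ℝ) else 0) with hB
  have hUB : ∀ i l : ZMod n, (modelCoordinate n m 0 * B) i l = if InRange m i then
      (if l.val = i.val + (m - 2) then 1 else 0) + (if l.val = i.val + (m - 1) then 1 else 0)
      else 0 := by
    intro i l
    rw [Matrix.mul_apply]
    by_cases hi : InRange m i
    · have h1 : 1 ≤ i.val := hi.1
      have h2 : i.val + m ≤ n := hi.2
      have hp1 : i.val + (m - 1) < n := by omega
      have hp2 : i.val + (m - 2) < n := by omega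
      have hv1 : ((i.val + (m - 1) : ℕ) : ZMod n).val = i.val + (m - 1) := ZMod.val_cast_of_lt hp1
      have hv2 : ((i.val + (m - 2) : ℕ) : ZMod n).val = i.val + (m - 2) := ZMod.val_cast_of_lt hp2
      simp only [modelCoordinate, Matrix.of_apply, if_pos hi, ite_self, zero_add, sub_mul, ite_mul,
        one_mul, zero_mul, Finset.sum_sub_distrib, val_eq_iff hp1, val_eq_iff hp2,
        Finset.sum_ite_eq', Finset.mem_univ, if_true]
      simp only [hB, midpointMatrix, Matrix.of_apply, hv1, hv2, ← val_eq_iff hp1, ← val_eq_iff hp2]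
      rw [if_pos (show m - 1 ≤ i.val + (m - 1) by omega),
        if_pos (show m - 1 ≤ i.val + (m - 2) by omega)]
      split_ifs <;> first | omega | norm_num
    · simp only [modelCoordinate, Matrix.of_apply, if_neg hi, ite_mul, one_mul, zero_mul,
        Finset.sum_ite_eq', Finset.mem_univ, if_true]
      rw [hB, midpointMatrix, Matrix.of_apply, if_neg (by rw [ZMod.val_zero]; omega)]
      simp
  ext i k
  rw [Matrix.mul_apply, Matrix.neg_apply, pathSkew_apply]
  simp only [hUB, Matrix.transpose_apply]
  by_cases hi : InRange m i
  · have h1 : 1 ≤ i.val := hi.1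
    have h2 : i.val + m ≤ n := hi.2
    have hp1 : i.val + (m - 1) < n := by omega
    have hp2 : i.val + (m - 2) < n := by omega
    have hv1 : ((i.val + (m - 1) : ℕ) : ZMod n).val = i.val + (m - 1) := ZMod.val_cast_of_lt hp1
    have hv2 : ((i.val + (m - 2) : ℕ) : ZMod n).val = i.val + (m - 2) := ZMod.val_cast_of_lt hp2
    simp only [if_pos hi, val_eq_iff hp1, val_eq_iff hp2, add_mul, ite_mul, one_mul, zero_mul,
      Finset.sum_add_distrib, Finset.sum_ite_eq', Finset.mem_univ, if_true]
    by_cases hk : InRange m k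
    · rw [if_pos ⟨hi, hk⟩]
      simp only [modelCoordinate, Matrix.of_apply, if_pos hk, hv1, hv2]
      split_ifs <;> first | omega | norm_num
    · rw [if_neg fun h => hk h.2]
      simp only [modelCoordinate, Matrix.of_apply, if_neg hk]
      rw [if_neg, if_neg]
      · simp
      · intro h; rw [h, ZMod.val_zero] at hv1; omega
      · intro h; rw [h, ZMod.val_zero] at hv2; omega
  · simp [hi]

theorem det_hankelTrace_model_ne_zero [NeZero n] (hm : 2 ≤ m) (hn : m + 2 ≤ n) {r : ℕ}
    (hr : 2 * r + m ≤ n) :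
    (hankelTrace (areaMatrix (modelCoordinate n m 0) *
      midpointMatrix (fun j : ZMod n => if m - 1 ≤ j.val then (1 : ℝ) else 0)) r).det ≠ 0 := by
  set U := modelCoordinate n m 0 with hU
  set B := midpointMatrix (fun j : ZMod n => if m - 1 ≤ j.val then (1 : ℝ) else 0) with hB
  set Z := pathSkew n m with hZ
  set P : Matrix (ZMod n) (ZMod n) ℝ :=
    Matrix.diagonal fun i => if InRange m i then 1 else 0 with hP
  have hPP : P * P = P := by
    rw [hP, Matrix.diagonal_mul_diagonal]
    congr 1
    funext i
    split_ifs <;> simp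
  have hPZP : P * Z * P = Z := by
    ext i k
    rw [hP, Matrix.mul_diagonal, Matrix.diagonal_mul, hZ, pathSkew_apply]
    by_cases hi : InRange m i <;> by_cases hk : InRange m k <;> simp [hi, hk]
  have hPSP : P * cyclicSkew n ℝ * P = Z := by
    ext i k
    rw [hP, Matrix.mul_diagonal, Matrix.diagonal_mul, hZ, pathSkew_apply, cyclicSkew,
      Matrix.of_apply]
    have hs : ∀ a b : ZMod n, InRange m a → (b = a + 1 ↔ b.val = a.val + 1) := by
      intro a b ha
      have ha2 : a.val + m ≤ n := ha.2
      rw [val_eq_iff (by omega)]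
      push_cast
      rw [ZMod.natCast_zmod_val]
    by_cases hi : InRange m i <;> by_cases hk : InRange m k <;> simp [hi, hk, hs]
  have h1 : hankelTrace (areaMatrix U * B) r = hankelTrace (-(Z * Z)) r := by
    calc hankelTrace (areaMatrix U * B) r
        = hankelTrace (U.transpose * (cyclicSkew n ℝ * U * B)) r := by
          rw [areaMatrix]; simp only [Matrix.mul_assoc]
      _ = hankelTrace (cyclicSkew n ℝ * (U * B * U.transpose)) r := by
          rw [hankelTrace_mul_comm]; simp only [Matrix.mul_assoc]
      _ = hankelTrace (-(cyclicSkew n ℝ * P * Z) * P) r := by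
          rw [modelCoordinate_mul_midpointMatrix_mul hm, ← hZ, ← hPZP, hPZP]
          conv_lhs => rw [← hPZP]
          simp only [Matrix.mul_assoc, Matrix.mul_neg, Matrix.neg_mul]
      _ = hankelTrace (-(P * cyclicSkew n ℝ * P * Z)) r := by
          rw [hankelTrace_mul_comm]; simp only [Matrix.mul_assoc, Matrix.mul_neg]
      _ = hankelTrace (-(Z * Z)) r := by rw [hPSP]
  rw [h1]
  exact det_hankelTrace_pathSkew_ne_zero (by omega) hr (by omega)

end PathMatrix

/-! ### A nondegenerate generic polygon -/

section Model

open Filter Topology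

variable {n m : ℕ}

/-- The sequence that starts with the standard basis and goes on with
`a (k + m) = a (k + m - 1) - e • a (k + 1) + a 0`. (For `m < 2` the recursion is not used.) -/
noncomputable def modelSeq (m : ℕ) (e : ℝ) (k : ℕ) (c : Fin m) : ℝ :=
  if h : k < m ∨ m < 2 then if (c : ℕ) = k then 1 else 0
  else modelSeq m e (k - 1) c - e * modelSeq m e (k + 1 - m) c + if (c : ℕ) = 0 then 1 else 0
termination_by k
decreasing_by all_goals omega

theorem modelSeq_of_lt (e : ℝ) {k : ℕ} (hk : k < m) (c : Fin m) :
    modelSeq m e k c = if (c : ℕ) = k then 1 else 0 := by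
  rw [modelSeq, dif_pos (Or.inl hk)]

theorem modelSeq_of_le (hm : 2 ≤ m) (e : ℝ) {k : ℕ} (hk : m ≤ k) (c : Fin m) :
    modelSeq m e k c = modelSeq m e (k - 1) c - e * modelSeq m e (k + 1 - m) c +
      if (c : ℕ) = 0 then 1 else 0 := by
  rw [modelSeq, dif_neg (by omega)]

theorem continuous_modelSeq (hm : 2 ≤ m) (k : ℕ) (c : Fin m) :
    Continuous fun e => modelSeq m e k c := by
  induction k using Nat.strong_induction_on with
  | _ k ih =>
    by_cases hk : k < m
    · simp only [modelSeq_of_lt _ hk]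
      exact continuous_const
    · simp only [modelSeq_of_le hm _ (not_lt.mp hk)]
      have h1 := ih (k - 1) (by omega)
      have h2 := ih (k + 1 - m) (by omega)
      fun_prop

theorem modelSeq_zero_last (hm : 2 ≤ m) {c : Fin m} (hc : (c : ℕ) = m - 1) (k : ℕ) :
    modelSeq m 0 k c = if m - 1 ≤ k then 1 else 0 := by
  induction k using Nat.strong_induction_on with
  | _ k ih =>
    by_cases hk : k < m
    · rw [modelSeq_of_lt _ hk, hc]
      split_ifs <;> first | rfl | omega
    · rw [modelSeq_of_le hm _ (not_lt.mp hk), ih (k - 1) (by omega), if_pos (by omega),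
        if_neg (by omega), if_pos (by omega)]
      ring

/-- A vector orthogonal to `m` consecutive members of the sequence is orthogonal to `a 0`, hence to
the preceding window, and finally to the standard basis. -/
theorem eq_zero_of_modelSeq (hm : 2 ≤ m) {e : ℝ} (he0 : e ≠ 0) (he1 : e ≠ 1) (k : ℕ)
    {x : Fin m → ℝ} (hx : ∀ r < m, modelSeq m e (k + r) ⬝ᵥ x = 0) : x = 0 := by
  induction k with
  | zero =>
    funext c
    have h := hx c c.2
    simp only [dotProduct, zero_add, modelSeq_of_lt e c.2] at h
    simpa [← Fin.ext_iff] using h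
  | succ k ih =>
    have hrec : ∀ k, m ≤ k → modelSeq m e k ⬝ᵥ x = modelSeq m e (k - 1) ⬝ᵥ x -
        e * (modelSeq m e (k + 1 - m) ⬝ᵥ x) + modelSeq m e 0 ⬝ᵥ x := by
      intro k hk
      simp only [dotProduct, modelSeq_of_le hm e hk, modelSeq_of_lt e (show 0 < m by omega),
        Finset.mul_sum, ← Finset.sum_sub_distrib, ← Finset.sum_add_distrib]
      refine Finset.sum_congr rfl fun c _ => ?_
      ring
    have hwin : ∀ j, k + 1 ≤ j → j < k + 1 + m → modelSeq m e j ⬝ᵥ x = 0 := by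
      intro j h1 h2
      have := hx (j - (k + 1)) (by omega)
      rwa [show k + 1 + (j - (k + 1)) = j by omega] at this
    have h0 : modelSeq m e 0 ⬝ᵥ x = 0 := by
      have h := hrec (k + m) (by omega)
      rw [hwin (k + m) (by omega) (by omega), hwin (k + m - 1) (by omega) (by omega),
        hwin (k + m + 1 - m) (by omega) (by omega)] at h
      linarith
    have hk : modelSeq m e k ⬝ᵥ x = 0 := by
      by_cases hk0 : k = 0
      · rw [hk0, h0]
      have h := hrec (k + m - 1) (by omega)
      rw [hwin (k + m - 1) (by omega) (by omega), h0, show k + m - 1 + 1 - m = k by omega] at h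
      by_cases hm2 : m = 2
      · rw [show k + m - 1 - 1 = k by omega] at h
        have h' : (1 - e) * (modelSeq m e k ⬝ᵥ x) = 0 := by linarith
        exact (mul_eq_zero.mp h').resolve_left (sub_ne_zero.mpr he1.symm)
      · rw [hwin (k + m - 1 - 1) (by omega) (by omega)] at h
        have h' : e * (modelSeq m e k ⬝ᵥ x) = 0 := by linarith
        exact (mul_eq_zero.mp h').resolve_left he0
    refine ih fun r hr => ?_
    by_cases hr0 : r = 0
    · rw [hr0, add_zero, hk]
    · exact hwin _ (by omega) (by omega)

/-- The polygon of directions formed by the first `n` members of the sequence. -/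
noncomputable def modelPolygon (n m : ℕ) (e : ℝ) (j : ZMod n) : Vec m :=
  WithLp.toLp 2 (modelSeq m e j.val)

theorem val_add_of_inRange [NeZero n] {i : ZMod n} (hi : InRange m i) {r : ℕ} (hr : r < m) :
    (i + (r : ZMod n)).val = i.val + r := by
  have h : i.val + m ≤ n := hi.2
  have : i + (r : ZMod n) = ((i.val + r : ℕ) : ZMod n) := by
    push_cast
    rw [ZMod.natCast_zmod_val]
  rw [this, ZMod.val_cast_of_lt (by omega)]

theorem det_rowMatrix_modelPolygon [NeZero n] (hm : 2 ≤ m) {e : ℝ} (he0 : e ≠ 0) (he1 : e ≠ 1)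
    {i : ZMod n} (hi : InRange m i) : (rowMatrix (modelPolygon n m e) i).det ≠ 0 := by
  intro hdet
  obtain ⟨x, hx0, hx⟩ := Matrix.exists_mulVec_eq_zero_iff.mpr hdet
  refine hx0 (eq_zero_of_modelSeq hm he0 he1 i.val fun r hr => ?_)
  have h := congrFun hx ⟨r, hr⟩
  rw [← val_add_of_inRange hi hr]
  exact h

theorem inv_row_eq_of_vecMul_eq {M : Matrix (Fin m) (Fin m) ℝ} (hM : M.det ≠ 0) {q : Fin m → ℝ}
    {c : Fin m} (h : Matrix.vecMul q M = Pi.single c 1) : M⁻¹ c = q := by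
  have h1 : Matrix.vecMul (Matrix.vecMul q M) M⁻¹ = q := by
    rw [Matrix.vecMul_vecMul, Matrix.mul_nonsing_inv _ hM.isUnit, Matrix.vecMul_one]
  rw [← h1, h, Matrix.single_one_vecMul]
  rfl

/-- On the windows inside the path the recursion expresses `a 0` through the window. -/
theorem inv_rowMatrix_modelPolygon [NeZero n] [NeZero m] (hm : 2 ≤ m) {e : ℝ} (he0 : e ≠ 0)
    (he1 : e ≠ 1) {i : ZMod n} (hi : InRange m i) (r : Fin m) :
    (rowMatrix (modelPolygon n m e) i)⁻¹ 0 r = (if (r : ℕ) = 0 then e else 0) +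
      (if (r : ℕ) = m - 1 then 1 else 0) - (if (r : ℕ) = m - 2 then 1 else 0) := by
  have hi1 : 1 ≤ i.val := hi.1
  refine congrFun (inv_row_eq_of_vecMul_eq (q := fun r : Fin m => (if (r : ℕ) = 0 then e else 0) +
      (if (r : ℕ) = m - 1 then 1 else 0) - (if (r : ℕ) = m - 2 then 1 else 0))
    (det_rowMatrix_modelPolygon hm he0 he1 hi) ?_) r
  funext c
  have hent : ∀ r : Fin m, rowMatrix (modelPolygon n m e) i r c = modelSeq m e (i.val + r) c := by
    intro r
    rw [← val_add_of_inRange hi r.2]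
    rfl
  have hsum : ∀ (k : ℕ) (hk : k < m) (a : ℝ) (f : ℕ → ℝ),
      ∑ r : Fin m, (if (r : ℕ) = k then a else 0) * f r = a * f k := by
    intro k hk a f
    rw [Finset.sum_eq_single ⟨k, hk⟩]
    · simp
    · intro b _ hb
      rw [if_neg (fun h => hb (Fin.ext h)), zero_mul]
    · simp
  simp only [Matrix.vecMul, dotProduct, hent, add_mul, sub_mul, Finset.sum_add_distrib,
    Finset.sum_sub_distrib]
  rw [hsum 0 (by omega) e fun r => modelSeq m e (i.val + r) c,
    hsum (m - 1) (by omega) 1 fun r => modelSeq m e (i.val + r) c,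
    hsum (m - 2) (by omega) 1 fun r => modelSeq m e (i.val + r) c,
    modelSeq_of_le hm e (show m ≤ i.val + (m - 1) by omega),
    show i.val + (m - 1) - 1 = i.val + (m - 2) by omega,
    show i.val + (m - 1) + 1 - m = i.val by omega, Pi.single_apply]
  simp only [Fin.ext_iff, Fin.val_zero]
  ring_nf

/-- The sequence of points of the moment curve; any `m` of them are linearly independent. -/
noncomputable def momentPolygon (n m : ℕ) (j : ZMod n) : Vec m :=
  WithLp.toLp 2 fun c : Fin m => (j.val : ℝ) ^ (c : ℕ)

theorem isGeneric_momentPolygon [NeZero n] (hn : m ≤ n) : IsGeneric (momentPolygon n m) := by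
  refine isGeneric_of_det fun i => ?_
  have h : rowMatrix (momentPolygon n m) i =
      Matrix.vandermonde fun r : Fin m => ((i + ((r : ℕ) : ZMod n)).val : ℝ) := rfl
  rw [h, Matrix.det_vandermonde_ne_zero_iff]
  intro r s hrs
  have h1 : ((r : ℕ) : ZMod n) = ((s : ℕ) : ZMod n) :=
    add_left_cancel (ZMod.val_injective n (Nat.cast_injective hrs))
  have h2 := congrArg ZMod.val h1
  rw [ZMod.val_cast_of_lt (lt_of_lt_of_le r.2 hn), ZMod.val_cast_of_lt (lt_of_lt_of_le s.2 hn)]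
    at h2
  exact Fin.ext h2

/-- If `v 0` is the first basis vector, then the first coordinate of a vertex on the hyperplane
with normal `v 0` is the height of this hyperplane. -/
theorem vertexCoordinate_zero_of_not_inRange [NeZero n] [NeZero m]
    {v : ZMod n → Vec m} (hv : IsGeneric v) (h0 : ∀ c, v 0 c = if (c : ℕ) = 0 then 1 else 0)
    {i : ZMod n} (hi : ¬InRange m i) (k : ZMod n) :
    vertexCoordinate v 0 i k = if k = 0 then 1 else 0 := by
  have hi' : i.val = 0 ∨ n < i.val + m := by
    unfold InRange at hi
    omega
  have hlt := ZMod.val_lt i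
  have hmpos := NeZero.pos m
  obtain ⟨r, hr⟩ : ∃ r : Fin m, i + ((r : ℕ) : ZMod n) = 0 := by
    rcases hi' with h | h
    · exact ⟨⟨0, hmpos⟩, by simp [(ZMod.val_eq_zero i).mp h]⟩
    · refine ⟨⟨n - i.val, by omega⟩, ?_⟩
      have h2 : ((i.val + (n - i.val) : ℕ) : ZMod n) = 0 := by
        rw [show i.val + (n - i.val) = n by omega, ZMod.natCast_self]
      push_cast at h2
      rwa [ZMod.natCast_zmod_val] at h2
  have hinv : (rowMatrix v i)⁻¹ 0 = Pi.single r 1 := by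
    refine inv_row_eq_of_vecMul_eq (det_rowMatrix_ne_zero hv i) ?_
    rw [Matrix.single_one_vecMul]
    funext c
    have : rowMatrix v i r c = v 0 c := by rw [← hr]; rfl
    rw [Matrix.row_apply, this, h0, Pi.single_apply]
    simp only [Fin.ext_iff, Fin.val_zero]
  simp only [vertexCoordinate, windowCoordinate, Matrix.of_apply, hinv]
  rw [Finset.sum_eq_single r]
  · simp only [hr, Pi.single_eq_same, eq_comm]
  · intro b _ hb
    rw [Pi.single_eq_of_ne hb, ite_self]
  · simp

theorem continuous_det_hankelTrace [NeZero n] (r : ℕ) :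
    Continuous fun p : Matrix (ZMod n) (ZMod n) ℝ × (ZMod n → ℝ) =>
      (hankelTrace (areaMatrix p.1 * midpointMatrix p.2) r).det := by
  have hB : Continuous fun p : Matrix (ZMod n) (ZMod n) ℝ × (ZMod n → ℝ) =>
      midpointMatrix p.2 := by
    refine continuous_matrix fun i j => ?_
    simp only [midpointMatrix, Matrix.of_apply]
    fun_prop
  have hA : Continuous fun p : Matrix (ZMod n) (ZMod n) ℝ × (ZMod n → ℝ) =>
      areaMatrix p.1 :=
    (continuous_fst.matrix_transpose.matrix_mul continuous_const).matrix_mul continuous_fst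
  refine Continuous.matrix_det (continuous_matrix fun i j => ?_)
  simp only [hankelTrace, Matrix.of_apply]
  exact ((hA.matrix_mul hB).pow _).matrix_trace

theorem tendsto_inv_apply {ι : Type*} {l : Filter ι} {M : ι → Matrix (Fin m) (Fin m) ℝ}
    {A : Matrix (Fin m) (Fin m) ℝ} (hA : A.det ≠ 0) (hM : Tendsto M l (𝓝 A)) (c r : Fin m) :
    Tendsto (fun t => (M t)⁻¹ c r) l (𝓝 (A⁻¹ c r)) := by
  have hdet : Tendsto (fun t => (M t).det) l (𝓝 A.det) :=
    (continuous_id.matrix_det.tendsto A).comp hM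
  have hadj : Tendsto (fun t => (M t).adjugate c r) l (𝓝 (A.adjugate c r)) :=
    ((continuous_id.matrix_adjugate.matrix_elem c r).tendsto A).comp hM
  simp only [Matrix.inv_def, Ring.inverse_eq_inv', Matrix.smul_apply, smul_eq_mul]
  exact (hdet.inv₀ hA).mul hadj

/-- A generic polygon for which the leading part of the second evolute map, formed with the first
coordinates of the dual vertices and the last coordinates of the directions, is nondegenerate. -/
theorem exists_isGeneric_det_hankelTrace_ne_zero [NeZero n] [NeZero m] (hm : 2 ≤ m)
    (hn : m + 2 ≤ n) {r : ℕ} (hr : 2 * r + m ≤ n) {c : Fin m} (hc : (c : ℕ) = m - 1) :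
    ∃ v : ZMod n → Vec m, IsGeneric v ∧ (hankelTrace (areaMatrix (vertexCoordinate v 0) *
      midpointMatrix fun j => v j c) r).det ≠ 0 := by
  set κ := fun p : Matrix (ZMod n) (ZMod n) ℝ × (ZMod n → ℝ) =>
      (hankelTrace (areaMatrix p.1 * midpointMatrix p.2) r).det with hκ
  have hκc : Continuous κ := continuous_det_hankelTrace r
  -- Choose the parameter so small that the model matrices are close to their limits.
  obtain ⟨e, he, he0, he1⟩ : ∃ e, κ (modelCoordinate n m e, fun j => modelPolygon n m e j c) ≠ 0 ∧
      e ≠ 0 ∧ e ≠ 1 := by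
    have hcont : Continuous fun e =>
        κ (modelCoordinate n m e, fun j => modelPolygon n m e j c) := by
      refine hκc.comp (Continuous.prodMk (continuous_matrix fun i k => ?_)
        (continuous_pi fun j => continuous_modelSeq hm _ _))
      simp only [modelCoordinate, Matrix.of_apply]
      split_ifs <;> fun_prop
    have h0 : κ (modelCoordinate n m 0, fun j => modelPolygon n m 0 j c) ≠ 0 := by
      have h1 : (fun j : ZMod n => modelPolygon n m 0 j c) =
          fun j => if m - 1 ≤ j.val then (1 : ℝ) else 0 :=
        funext fun j => modelSeq_zero_last hm hc j.val
      rw [h1]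
      exact det_hankelTrace_model_ne_zero hm hn hr
    have h1 : ∀ᶠ e in 𝓝[≠] (0 : ℝ),
        κ (modelCoordinate n m e, fun j => modelPolygon n m e j c) ≠ 0 :=
      nhdsWithin_le_nhds (hcont.continuousAt.eventually_ne h0)
    have h2 : ∀ᶠ e in 𝓝[≠] (0 : ℝ), e ≠ 1 :=
      nhdsWithin_le_nhds (eventually_ne_nhds zero_ne_one)
    exact (h1.and ((eventually_mem_nhdsWithin).and h2)).exists
  -- Move from the model polygon towards the moment polygon, which makes the polygon generic.
  set w := modelPolygon n m e with hw
  let x : ℝ → ZMod n → Vec m := fun t j => w j + t • (momentPolygon n m j - w j)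
  have hgen : ∀ᶠ t in 𝓝[≠] (0 : ℝ), IsGeneric (x t) := by
    have h := eventually_line_ne_zero (F := fun {R} _ v => windowDetProd v)
      (fun f v => windowDetProd_map f v) (fun j c => w j c) (fun j c => momentPolygon n m j c)
      ((windowDetProd_ne_zero_iff _).mpr (isGeneric_momentPolygon (by omega)))
    filter_upwards [h] with t ht
    exact (windowDetProd_ne_zero_iff (x t)).mp ht
  have hx0 : ∀ t c, x t 0 c = if (c : ℕ) = 0 then 1 else 0 := by
    intro t c
    have h1 : w 0 c = if (c : ℕ) = 0 then 1 else 0 := by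
      have : w 0 c = modelSeq m e (0 : ZMod n).val c := rfl
      rw [this, ZMod.val_zero, modelSeq_of_lt e (by omega)]
    have h2 : momentPolygon n m 0 c = if (c : ℕ) = 0 then 1 else 0 := by
      have : momentPolygon n m 0 c = (((0 : ZMod n).val : ℕ) : ℝ) ^ (c : ℕ) := rfl
      rw [this, ZMod.val_zero, Nat.cast_zero, zero_pow_eq]
    simp only [x, PiLp.add_apply, PiLp.smul_apply, PiLp.sub_apply, h1, h2]
    simp
  have hxc : ∀ j c, Continuous fun t => x t j c := by
    intro j c
    simp only [x, PiLp.add_apply, PiLp.smul_apply, PiLp.sub_apply, smul_eq_mul]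
    fun_prop
  have hxz : ∀ j c, x 0 j c = w j c := by
    intro j c
    simp [x]
  have hlim : Tendsto (fun t => (vertexCoordinate (x t) 0, fun j => x t j c)) (𝓝[≠] 0)
      (𝓝 (modelCoordinate n m e, fun j => w j c)) := by
    refine Tendsto.prodMk_nhds (tendsto_pi_nhds.mpr fun i => tendsto_pi_nhds.mpr fun k => ?_)
      (tendsto_pi_nhds.mpr fun j => ?_)
    · by_cases hi : InRange m i
      · have hA : Tendsto (fun t => rowMatrix (x t) i) (𝓝[≠] 0) (𝓝 (rowMatrix w i)) := by
          refine tendsto_pi_nhds.mpr fun r => tendsto_pi_nhds.mpr fun c => ?_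
          have h := ((hxc (i + ((r : ℕ) : ZMod n)) c).tendsto 0).mono_left
            (nhdsWithin_le_nhds (s := {0}ᶜ))
          rw [hxz] at h
          exact h
        have hq := fun r => tendsto_inv_apply (det_rowMatrix_modelPolygon hm he0 he1 hi) hA 0 r
        have hval : modelCoordinate n m e i k = ∑ r : Fin m, if i + ((r : ℕ) : ZMod n) = k then
            (rowMatrix w i)⁻¹ 0 r else 0 := by
          have hik : ∀ r : Fin m, (i + ((r : ℕ) : ZMod n) = k ↔ k.val = i.val + r) := by
            intro r
            rw [← val_add_of_inRange hi r.2]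
            exact ⟨fun h => by rw [h], fun h => (ZMod.val_injective n h).symm⟩
          simp only [hw, inv_rowMatrix_modelPolygon hm he0 he1 hi, hik]
          rw [modelCoordinate, Matrix.of_apply, if_pos hi]
          by_cases hex : ∃ r : Fin m, k.val = i.val + r
          · obtain ⟨r, hkr⟩ := hex
            rw [Finset.sum_eq_single r]
            · rw [if_pos hkr]
              simp only [hkr, Nat.add_left_cancel_iff, Nat.add_eq_left]
            · intro b _ hb
              rw [if_neg]
              intro h
              exact hb (Fin.ext (by omega))
            · simp
          · push Not at hex
            have h1 := hex ⟨0, by omega⟩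
            have h2 := hex ⟨m - 1, by omega⟩
            have h3 := hex ⟨m - 2, by omega⟩
            simp only [add_zero] at h1 h2 h3
            rw [if_neg h1, if_neg h2, if_neg h3, Finset.sum_eq_zero fun r _ => if_neg (hex r)]
            ring
        rw [hval]
        simp only [vertexCoordinate, windowCoordinate, Matrix.of_apply]
        refine tendsto_finsetSum _ fun r _ => ?_
        split_ifs
        · exact hq r
        · exact tendsto_const_nhds
      · rw [modelCoordinate, Matrix.of_apply, if_neg hi]
        refine tendsto_const_nhds.congr' ?_
        filter_upwards [hgen] with t ht
        exact (vertexCoordinate_zero_of_not_inRange ht (hx0 t) hi k).symm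
    · have h := ((hxc j c).tendsto 0).mono_left (nhdsWithin_le_nhds (s := {0}ᶜ))
      rwa [hxz] at h
  have hne := ((hκc.tendsto _).comp hlim).eventually_ne he
  obtain ⟨t, ht, htg⟩ := (hne.and hgen).exists
  exact ⟨x t, htg, ht⟩

/-! ### Stretching one coordinate and compressing another one -/

theorem rowMatrix_scale {v v' : ZMod n → Vec m} {s : Fin m → ℝ}
    (h : ∀ j c, v' j c = s c * v j c) (i : ZMod n) :
    rowMatrix v' i = rowMatrix v i * Matrix.diagonal s := by
  ext r c
  rw [Matrix.mul_diagonal, mul_comm]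
  exact h _ c

theorem vertexCoordinate_scale [NeZero n] {v v' : ZMod n → Vec m} {s : Fin m → ℝ}
    (hs : ∀ c, s c ≠ 0) (h : ∀ j c, v' j c = s c * v j c) (c : Fin m) :
    vertexCoordinate v' c = (s c)⁻¹ • vertexCoordinate v c := by
  have hinv : (Matrix.diagonal s)⁻¹ = Matrix.diagonal fun c => (s c)⁻¹ := by
    refine Matrix.inv_eq_right_inv ?_
    rw [Matrix.diagonal_mul_diagonal, ← Matrix.diagonal_one]
    congr 1
    funext r
    exact mul_inv_cancel₀ (hs _)
  ext i k
  simp only [vertexCoordinate, windowCoordinate, Matrix.of_apply, Matrix.smul_apply, smul_eq_mul,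
    rowMatrix_scale h, Matrix.mul_inv_rev, hinv, Matrix.diagonal_mul, Finset.mul_sum, mul_ite,
    mul_zero]

theorem midpointMatrix_scale (s : ℝ) (x : ZMod n → ℝ) :
    midpointMatrix (fun j => s * x j) = (s * s) • midpointMatrix x := by
  ext i j
  simp only [midpointMatrix, Matrix.of_apply, Matrix.smul_apply, smul_eq_mul]
  ring

/-- When the last coordinate is stretched by `a⁻¹` and the first one by `a`, the matrix of the
second evolute map, multiplied by `a ^ 4`, tends for `a → 0` to the product of the area matrix of
the first coordinates of the dual vertices and the midpoint matrix of the last coordinates. -/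
theorem exists_nondegeneracyPoly_ne_zero [NeZero n] [NeZero m] (hm : 2 ≤ m) (hn : m + 2 ≤ n)
    {r : ℕ} (hr : 2 * r + m ≤ n) :
    ∃ w : ZMod n → Vec m, nondegeneracyPoly (fun j c => w j c) r ≠ 0 := by
  let d : Fin m := ⟨m - 1, by omega⟩
  obtain ⟨v, hv, hdet⟩ := exists_isGeneric_det_hankelTrace_ne_zero (n := n) hm hn hr
    (c := d) rfl
  have hd : d ≠ 0 := by
    intro h
    have := congrArg Fin.val h
    simp only [d, Fin.val_zero] at this
    omega
  let J : ℝ → Matrix (ZMod n) (ZMod n) ℝ := fun a => ∑ c,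
    (if c = 0 then 1 else if c = d then a ^ 4 else a ^ 2) • areaMatrix (vertexCoordinate v c)
  let B : ℝ → Matrix (ZMod n) (ZMod n) ℝ := fun a => ∑ c,
    (if c = d then 1 else if c = 0 then a ^ 4 else a ^ 2) • midpointMatrix fun j => v j c
  have hcont : Continuous fun a => (hankelTrace (J a * B a) r).det := by
    have hJ : Continuous J := by
      refine continuous_finsetSum _ fun c _ => ?_
      have h : Continuous fun a : ℝ => if c = 0 then 1 else if c = d then a ^ 4 else a ^ 2 := by
        split_ifs <;> fun_prop
      exact h.smul continuous_const
    have hB : Continuous B := by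
      refine continuous_finsetSum _ fun c _ => ?_
      have h : Continuous fun a : ℝ => if c = d then 1 else if c = 0 then a ^ 4 else a ^ 2 := by
        split_ifs <;> fun_prop
      exact h.smul continuous_const
    refine Continuous.matrix_det (continuous_matrix fun i j => ?_)
    simp only [hankelTrace, Matrix.of_apply]
    exact ((hJ.matrix_mul hB).pow _).matrix_trace
  have hJ0 : J 0 = areaMatrix (vertexCoordinate v 0) := by
    simp only [J]
    rw [Finset.sum_eq_single 0]
    · simp
    · intro b _ hb
      rw [if_neg hb]
      split_ifs <;> simp
    · simp
  have hB0 : B 0 = midpointMatrix fun j => v j d := by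
    simp only [B]
    rw [Finset.sum_eq_single d]
    · simp
    · intro b _ hb
      rw [if_neg hb]
      split_ifs <;> simp
    · simp
  have hne : ∀ᶠ a in 𝓝[≠] (0 : ℝ), (hankelTrace (J a * B a) r).det ≠ 0 :=
    nhdsWithin_le_nhds (hcont.continuousAt.eventually_ne (by rw [hJ0, hB0]; exact hdet))
  obtain ⟨a, ha, ha0⟩ := (hne.and eventually_mem_nhdsWithin).exists
  have ha0' : a ≠ 0 := ha0
  let s : Fin m → ℝ := fun c => if c = d then a⁻¹ else if c = 0 then a else 1
  have hs : ∀ c, s c ≠ 0 := by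
    intro c
    simp only [s]
    split_ifs
    · exact inv_ne_zero ha0'
    · exact ha0'
    · exact one_ne_zero
  let w : ZMod n → Vec m := fun j => WithLp.toLp 2 fun c => s c * v j c
  have hw : ∀ j c, w j c = s c * v j c := fun j c => rfl
  refine ⟨w, (nondegeneracyPoly_ne_zero_iff w r).mpr ⟨isGeneric_of_det fun i => ?_, ?_⟩⟩
  · rw [rowMatrix_scale hw, Matrix.det_mul, Matrix.det_diagonal]
    exact mul_ne_zero (det_rowMatrix_ne_zero hv i) (Finset.prod_ne_zero_iff.mpr fun c _ => hs c)
  · have hJa : (a ^ 2) • ∑ c, areaMatrix (vertexCoordinate w c) = J a := by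
      rw [Finset.smul_sum]
      refine Finset.sum_congr rfl fun c _ => ?_
      rw [vertexCoordinate_scale hs hw, areaMatrix_smul, smul_smul]
      congr 1
      simp only [s]
      by_cases h1 : c = d
      · rw [if_pos h1, if_neg (h1 ▸ hd), if_pos h1]
        field_simp
      · rw [if_neg h1]
        by_cases h2 : c = 0
        · rw [if_pos h2, if_pos h2]
          field_simp
        · rw [if_neg h2, if_neg h2, if_neg h1]
          field_simp
    have hBa : (a ^ 2) • ∑ c, midpointMatrix (fun j => w j c) = B a := by
      rw [Finset.smul_sum]
      refine Finset.sum_congr rfl fun c _ => ?_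
      simp only [hw]
      rw [midpointMatrix_scale, smul_smul]
      congr 1
      simp only [s]
      by_cases h1 : c = d
      · rw [if_pos h1, if_pos h1]
        field_simp
      · rw [if_neg h1, if_neg h1]
        by_cases h2 : c = 0
        · rw [if_pos h2, if_pos h2]
          ring
        · rw [if_neg h2, if_neg h2]
          ring
    have hM : (a ^ 2 * a ^ 2) • evoluteMatrixOf w = J a * B a := by
      rw [← hJa, ← hBa, Matrix.smul_mul, Matrix.mul_smul, smul_smul]
      rfl
    rw [← hM] at ha
    exact (det_hankelTrace_smul_ne_zero
      (mul_ne_zero (pow_ne_zero 2 ha0') (pow_ne_zero 2 ha0')) _ _).mp ha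

end Model

theorem theorem2p13 (n m : ℕ) [NeZero n] [NeZero m] (hm : 2 ≤ m) (hn : m + 2 ≤ n) :
    (∀ (v : SphericalPolygon n m) (hv : IsGeneric v.vec),
      (∀ μ : ℂ, μ ≠ 0 → Even (eigenvalueMultiplicity v.vec hv μ)) ∧
      ∃ (k : ℕ) (A : Matrix (Fin k) (Fin k) ℝ)
        (b : Module.Basis (Fin k ⊕ Fin k) ℝ (evoluteImage v.vec hv)),
        LinearMap.toMatrix b b (secondEvoluteOnImage v.vec hv) =
          Matrix.fromBlocks A 0 0 A.transpose) ∧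
    ∃ G : Set (SphericalPolygon n m), IsOpen G ∧ Dense G ∧
      ∀ v ∈ G, ∃ hv : IsGeneric v.vec, ∀ μ : ℂ, μ ≠ 0 →
        eigenvalueMultiplicity v.vec hv μ ≠ 0 → eigenvalueMultiplicity v.vec hv μ = 2 := by
  refine ⟨fun v hv => ⟨fun μ hμ => even_eigenvalueMultiplicity hv hμ,
    exists_basis_secondEvoluteOnImage hv⟩, nondegeneratePolygons n m ((n - m) / 2),
    isOpen_nondegeneratePolygons _, ?_, fun v hvG => ?_⟩
  · obtain ⟨w, hw⟩ := exists_nondegeneracyPoly_ne_zero (n := n) (r := (n - m) / 2) hm hn (by omega)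
    exact dense_nondegeneratePolygons hw
  · obtain ⟨hv, hdet⟩ := (nondegeneracyPoly_ne_zero_iff v.vec _).mp hvG
    exact ⟨hv, fun μ hμ hμ0 => eigenvalueMultiplicity_eq_two hv hdet hμ hμ0⟩
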